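/- All representations are finite-dimensional and complex. For a class function $f$ on $S_n$ let $\mathrm{ch}(f)=\frac1{n!}\sum_{w\in S_n}f(w)\,p_{\lambda(w)}$ be its Frobenius characteristic, where $\lambda(w)$ is the cycle type of $w$ and $p_\lambda$ is the power sum symmetric function. Let $h_m$ and $e_m$ be the complete homogeneous and the elementary symmetric functions, and let $f[g]$ denote plethysm of symmetric functions. For $n\ge1$ let $C_n\subset S_n$ be generated by an $n$-cycle $c$, let $\chi_\zeta:C_n\to\mathbb C^\times$ be a linear character sending $c$ to a primitive $n$-th root of unity, and put $$\mathrm{Lie}_{(n)}=\chi_\zeta\uparrow_{C_n}^{S_n},\qquad \ell_n=\mathrm{ch}(\mathrm{Lie}_{(n)}),\qquad \pi_n=\mathrm{ch}(\epsilon_{S_n}\otimes\mathrm{Lie}_{(n)}),$$ where $\epsilon_{S_n}$ is the sign character. For a partition $\lambda=1^{m_1}2^{m_2}\cdots$ of $n$ let $\mathrm{Lie}_\lambda$ and $\mathrm W_\lambda$ be the $S_n$-representations (unique up to isomorphism) whose characters satisfy $$\mathrm{ch}(\mathrm{Lie}_\lambda)=\prod_{j\ge1}h_{m_j}[\ell_j],\qquad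 \mathrm{ch}(\mathrm W_\lambda)=\prod_{j\text{ odd}}h_{m_j}[\pi_j]\ \prod_{j\text{ even}}e_{m_j}[\pi_j].$$ For $n,i\ge0$ let $$\widehat{\mathrm{Lie}}^i_n=\bigoplus_\lambda\mathrm{Lie}_\lambda,\qquad \widehat{\mathrm W}^i_n=\bigoplus_\lambda\mathrm W_\lambda,$$ where both sums run over the partitions $\lambda$ of $n$ with no parts of size $1$ and with rank $\sum_k(\lambda_k-1)=i$. (For $n=0$ the empty partition, of rank $0$, is allowed, so $\widehat{\mathrm{Lie}}^0_0=\widehat{\mathrm W}^0_0$ is the trivial representation of $S_0$; an empty sum is the zero representation.) **Theorem.** The representations $\widehat{\mathrm{Lie}}^i_n$ and $\widehat{\mathrm W}^i_n$ exist for all $n,i\ge0$, that is, the symmetric functions $\sum_\lambda\mathrm{ch}(\mathrm{Lie}_\lambda)$ and $\sum_\lambda\mathrm{ch}(\mathrm W_\lambda)$ given by the formulas above are Frobenius characteristics of genuine $S_n$-representations. For all $n\ge2$ and $i\ge1$ there are isomorphisms of $S_{n-1}$-representations $$\widehat{\mathrm{Lie}}^{i}_{n}\downarrow\ \cong\ \left(\widehat{\mathrm{Lie}}^{i-1}_{n-1}\downarrow\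 \oplus\ \widehat{\mathrm{Lie}}^{i-1}_{n-2}\right)\uparrow,\qquad \widehat{\mathrm W}^{i}_{n}\downarrow\ \cong\ \left(\widehat{\mathrm W}^{i-1}_{n-1}\downarrow\ \oplus\ \widehat{\mathrm W}^{i-1}_{n-2}\right)\uparrow,$$ where $\downarrow$ is restriction from $S_m$ to $S_{m-1}$ and $\uparrow$ is induction from $S_{m-1}$ to $S_m$, with $S_{m-1}\subset S_m$ the stabilizer of the letter $m$ (on the right-hand sides, induction from $S_{n-2}$ to $S_{n-1}$). -/

import Mathlib

open scoped BigOperators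

noncomputable section

namespace HigherLie

/-! ### Symmetric functions -/

/-- The ring `Λ` of symmetric functions with complex coefficients, in its standard presentation
`Λ = ℂ[p₁, p₂, p₃, …]` as the polynomial ring on the power sums: the variable `X k` is `p_k`. -/
abbrev SymmFun : Type := MvPolynomial ℕ+ ℂ

/-- The power sum `p_k`, for `k ≥ 1`. -/
def p (k : ℕ) : SymmFun := MvPolynomial.X k.toPNat'

/-- `p_μ = p_{μ₁} p_{μ₂} ⋯` for a partition `μ` of `n`. -/
def pPart {n : ℕ} (μ : n.Partition) : SymmFun := (μ.parts.map p).prod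

/-- The Frobenius characteristic `ch f = (1 / n!) ∑_{w ∈ S_n} f(w) p_{λ(w)}`, where `λ(w)` is the
cycle type of `w`, with the fixed points counted as parts equal to `1`. -/
def ch (n : ℕ) (f : Equiv.Perm (Fin n) → ℂ) : SymmFun :=
  MvPolynomial.C ((n.factorial : ℂ)⁻¹) *
    ∑ w : Equiv.Perm (Fin n), MvPolynomial.C (f w) * pPart w.partition

/-- The complete homogeneous symmetric function `h_m = ∑_{μ ⊢ m} p_μ / z_μ`, that is, the Frobenius
image of the trivial character of `S_m`. -/
def h (m : ℕ) : SymmFun := ch m fun _ => 1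

/-- The sign character of `S_n` with complex values. -/
def sgn {n : ℕ} (w : Equiv.Perm (Fin n)) : ℂ := ((Equiv.Perm.sign w : ℤ) : ℂ)

/-- The elementary symmetric function `e_m = ∑_{μ ⊢ m} ε_μ p_μ / z_μ`, that is, the Frobenius image
of the sign character of `S_m`. -/
def e (m : ℕ) : SymmFun := ch m sgn

/-- The operation `g(x₁, x₂, …) ↦ g(x₁ᵏ, x₂ᵏ, …)` on symmetric functions: it is the ring
homomorphism with `p_j ↦ p_{kj}`. -/
def powerSubst (k : ℕ+) : SymmFun →ₐ[ℂ] SymmFun := MvPolynomial.rename fun j => k * j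

/-- Plethysm `f[g]`: the map `f ↦ f[g]` is the ring homomorphism such that
`p_k[g] = g(x₁ᵏ, x₂ᵏ, …)`. -/
def plethysm (f g : SymmFun) : SymmFun := MvPolynomial.aeval (fun k => powerSubst k g) f

/-! ### The Lie character -/

/-- The subgroup `C_n = ⟨c⟩` of `S_n` generated by the `n`-cycle `c = finRotate n`. -/
abbrev cyc (n : ℕ) : Subgroup (Equiv.Perm (Fin n)) := Subgroup.zpowers (finRotate n)

/-- The generator `c` of `C_n`. -/
def cycGen (n : ℕ) : cyc n := ⟨finRotate n, Subgroup.mem_zpowers _⟩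

/-- The primitive `n`-th root of unity `ζ = exp(2πi/n)`. -/
def zeta (n : ℕ) : ℂˣ :=
  Units.mk0 (Complex.exp (2 * Real.pi * Complex.I / n)) (Complex.exp_ne_zero _)

theorem mem_zpowers_cycGen (n : ℕ) (x : cyc n) : x ∈ Subgroup.zpowers (cycGen n) := by
  obtain ⟨x, k, rfl⟩ := x
  exact ⟨k, by ext1; simp [cycGen]⟩

theorem orderOf_zeta_dvd (n : ℕ) : orderOf (zeta n) ∣ orderOf (cycGen n) := by
  rcases n with _ | _ | n
  · have : zeta 0 = 1 := by ext; simp [zeta]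
    simp [this]
  · have : zeta 1 = 1 := by ext; simp [zeta, Complex.exp_two_pi_mul_I]
    simp [this]
  · have h1 : orderOf (cycGen (n + 2)) = n + 2 := by
      have h2 : orderOf (finRotate (n + 2)) = n + 2 := by
        rw [isCycle_finRotate.orderOf, support_finRotate, Finset.card_univ, Fintype.card_fin]
      rw [← Subgroup.orderOf_coe]
      exact h2
    have h3 := (Complex.isPrimitiveRoot_exp (n + 2) (by omega)).pow_eq_one
    have h4 : zeta (n + 2) ^ (n + 2) = 1 := by
      ext
      simpa [zeta] using h3
    rw [show n + 1 + 1 = n + 2 from rfl, h1]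
    exact orderOf_dvd_of_pow_eq_one h4

/-- The linear character `χ_ζ : C_n → ℂˣ` with `χ_ζ(c) = ζ`. -/
def chiZeta (n : ℕ) : cyc n →* ℂˣ :=
  monoidHomOfForallMemZpowers (mem_zpowers_cycGen n) (orderOf_zeta_dvd n)

/-- The one-dimensional representation of `C_n` on `ℂ` afforded by `χ_ζ`. -/
def chiZetaRep (n : ℕ) : Representation ℂ (cyc n) ℂ :=
  ((Algebra.lmul ℂ ℂ : ℂ →ₐ[ℂ] Module.End ℂ ℂ) : ℂ →* Module.End ℂ ℂ).comp
    ((Units.coeHom ℂ).comp (chiZeta n))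

/-- The representation `Lie_(n) = χ_ζ ↑_{C_n}^{S_n}`. -/
def lieRep (n : ℕ) :
    Representation ℂ (Equiv.Perm (Fin n)) (Representation.IndV (cyc n).subtype (chiZetaRep n)) :=
  Representation.ind (cyc n).subtype (chiZetaRep n)

/-- `ℓ_n = ch(Lie_(n))`. -/
def ell (n : ℕ) : SymmFun := ch n (lieRep n).character

/-- `π_n = ch(ε ⊗ Lie_(n))`. -/
def piSymm (n : ℕ) : SymmFun := ch n fun w => sgn w * (lieRep n).character w

/-! ### Higher Lie characters and Whitney homology characters -/

/-- The Frobenius image `∏_j h_{m_j}[ℓ_j]` of `Lie_μ`, for the partition `μ = 1^{m₁} 2^{m₂} ⋯`;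
the parts `j` with `m_j = 0` would contribute the factor `1`. -/
def chLie {n : ℕ} (μ : n.Partition) : SymmFun :=
  ∏ j ∈ μ.parts.toFinset, plethysm (h (μ.parts.count j)) (ell j)

/-- The Frobenius image `∏_{j odd} h_{m_j}[π_j] ∏_{j even} e_{m_j}[π_j]` of `W_μ`, for the
partition `μ = 1^{m₁} 2^{m₂} ⋯`. -/
def chW {n : ℕ} (μ : n.Partition) : SymmFun :=
  ∏ j ∈ μ.parts.toFinset,
    if Odd j then plethysm (h (μ.parts.count j)) (piSymm j)
    else plethysm (e (μ.parts.count j)) (piSymm j)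

/-- The rank `∑_k (μ_k - 1)` of a partition; its parts are positive. -/
def rank {n : ℕ} (μ : n.Partition) : ℕ := (μ.parts.map fun k => k - 1).sum

/-- The partitions of `n` of rank `i` with no parts of size `1`. -/
def hatPartitions (n i : ℕ) : Finset n.Partition :=
  Finset.univ.filter fun μ => 1 ∉ μ.parts ∧ rank μ = i

/-- The Frobenius image of `Lie-hat^i_n`, the direct sum of the `Lie_μ` over the partitions `μ` of
`n` of rank `i` with no parts of size `1`. -/
def chLieHat (n i : ℕ) : SymmFun := ∑ μ ∈ hatPartitions n i, chLie μ

/-- The Frobenius image of `W-hat^i_n`, the direct sum of the `W_μ` over the partitions `μ` of `n`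
of rank `i` with no parts of size `1`. -/
def chWHat (n i : ℕ) : SymmFun := ∑ μ ∈ hatPartitions n i, chW μ

/-! ### Representations of symmetric groups -/

/-- The finite-dimensional complex `S_n`-representation `ρ` has the Frobenius image `F`: its
character has Frobenius characteristic `F`. This determines `ρ` up to isomorphism. -/
structure HasFrobeniusImage {n : ℕ} {V : Type*} [AddCommGroup V] [Module ℂ V]
    (ρ : Representation ℂ (Equiv.Perm (Fin n)) V) (F : SymmFun) : Prop where
  finiteDimensional : FiniteDimensional ℂ V
  ch_character : ch n ρ.character = F

/-- `ρ` is the representation `Lie-hat^i_n` (up to isomorphism). -/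
def IsLieHat (n i : ℕ) {V : Type*} [AddCommGroup V] [Module ℂ V]
    (ρ : Representation ℂ (Equiv.Perm (Fin n)) V) : Prop :=
  HasFrobeniusImage ρ (chLieHat n i)

/-- `ρ` is the representation `W-hat^i_n` (up to isomorphism). -/
def IsWHat (n i : ℕ) {V : Type*} [AddCommGroup V] [Module ℂ V]
    (ρ : Representation ℂ (Equiv.Perm (Fin n)) V) : Prop :=
  HasFrobeniusImage ρ (chWHat n i)

/-- The standard embedding `S_m ⊂ S_n` for `m ≤ n`: a permutation of the first `m` letters is
extended by the identity on the remaining letters. -/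
def incl {m n : ℕ} (hmn : m ≤ n) : Equiv.Perm (Fin m) →* Equiv.Perm (Fin n) :=
  Equiv.Perm.viaEmbeddingHom (Fin.castLEEmb hmn)

/-- Restriction `ρ ↓` from `S_n` to `S_{n-1}`. -/
abbrev res {n : ℕ} {V : Type*} [AddCommGroup V] [Module ℂ V]
    (ρ : Representation ℂ (Equiv.Perm (Fin n)) V) :
    Representation ℂ (Equiv.Perm (Fin (n - 1))) V :=
  ρ.comp (incl (Nat.sub_le n 1))

/-- Induction `ρ ↑` from `S_{n-1}` to `S_n`. -/
abbrev ind (n : ℕ) {V : Type*} [AddCommGroup V] [Module ℂ V]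
    (ρ : Representation ℂ (Equiv.Perm (Fin (n - 1))) V) :
    Representation ℂ (Equiv.Perm (Fin n)) (Representation.IndV (incl (Nat.sub_le n 1)) ρ) :=
  Representation.ind (incl (Nat.sub_le n 1)) ρ

end HigherLie

end

/-! Under the Frobenius characteristic, restriction from $S_n$ to $S_{n-1}$ becomes
$\partial=\partial/\partial p_1$ (`dp_ch`) and induction becomes multiplication by $p_1$
(`ch_character_ind_incl`). Characters determine representations, so each isomorphism amounts to
$\partial F^i_n=p_1(\partial F^{i-1}_{n-1}+F^{i-1}_{n-2})$ for the Frobenius images $F$.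

A nontrivial element of $C_n$ has no fixed letter, so only the identity survives in
$\partial\ell_n=\partial\pi_n=p_1^{n-1}$. The chain rule for plethysm gives
$\partial(h_m[\ell_j])=h_{m-1}[\ell_j]\,p_1^{j-1}$, and likewise for $\pi_j$ and for $e_m$. Hence
$\partial F^i_n$ is a sum over pairs of a part $j\ge2$ and the multiset of remaining parts, with
weight $p_1^{j-1}$ times the product for the remaining parts. Pairs with $j\ge3$ become pairs for
$(n-1,i-1)$ on lowering $j$ by one, at the cost of one factor $p_1$; pairs with $j=2$ give
$p_1F^{i-1}_{n-2}$ (`dp_sum_hatParts`).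

For existence, each product is the cycle index of a finite permutation group weighted by a linear
character, hence the characteristic of an induced linear character. Such cycle indices are closed
under products (direct products of groups) and under plethysm by $h_m$ and $e_m$ (wreath products,
`cycleIndex_wreath`). -/

noncomputable section

namespace HigherLie

/-! ### Characters of finite groups: isomorphism criterion and induction. -/

section Representations

open Representation

section Characters

variable {G : Type*} [Group G] {V W : Type*} [AddCommGroup V] [Module ℂ V]
  [AddCommGroup W] [Module ℂ W]

theorem character_prod (ρ : Representation ℂ G V) (σ : Representation ℂ G W)
    [FiniteDimensional ℂ V] [FiniteDimensional ℂ W] :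
    (ρ.prod σ).character = ρ.character + σ.character := by
  ext g
  exact LinearMap.trace_prodMap' (ρ g) (σ g)

/-- A representation is the product of two complementary subrepresentations. -/
def prodEquivOfIsCompl {ρ : Representation ℂ G V} (S T : Subrepresentation ρ)
    (hST : IsCompl S.toSubmodule T.toSubmodule) :
    (S.toRepresentation.prod T.toRepresentation).Equiv ρ :=
  Representation.Equiv.mk (Submodule.prodEquivOfIsCompl _ _ hST) fun g => by
    ext x <;> simp [Subrepresentation.toRepresentation]

/-- The product of two equivalences of representations. -/
def prodEquivCongr {V' W' : Type*} [AddCommGroup V'] [Module ℂ V'] [AddCommGroup W'] [Module ℂ W']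
    {ρ : Representation ℂ G V} {σ : Representation ℂ G W}
    {ρ' : Representation ℂ G V'} {σ' : Representation ℂ G W'}
    (f : ρ.Equiv ρ') (g : σ.Equiv σ') : (ρ.prod σ).Equiv (ρ'.prod σ') :=
  Representation.Equiv.mk (f.toLinearEquiv.prodCongr g.toLinearEquiv) fun x => by
    refine LinearMap.ext fun v => Prod.ext ?_ ?_
    · exact f.toIntertwiningMap.isIntertwining _ _ x v.1
    · exact g.toIntertwiningMap.isIntertwining _ _ x v.2

/-- Swapping the factors of a product of representations. -/
def prodEquivComm (ρ : Representation ℂ G V) (σ : Representation ℂ G W) :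
    (ρ.prod σ).Equiv (σ.prod ρ) :=
  Representation.Equiv.mk (LinearEquiv.prodComm ℂ V W) fun x => by
    ext <;> simp

theorem exists_isCompl_subrepresentation [Finite G] {ρ : Representation ℂ G V}
    (S : Subrepresentation ρ) :
    ∃ T : Subrepresentation ρ, IsCompl S.toSubmodule T.toSubmodule := by
  obtain ⟨T, hT⟩ := exists_isCompl S
  refine ⟨T, ?_, ?_⟩
  · rw [disjoint_iff]
    exact congrArg Subrepresentation.toSubmodule (disjoint_iff.1 hT.1)
  · rw [codisjoint_iff]
    exact congrArg Subrepresentation.toSubmodule (codisjoint_iff.1 hT.2)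

/-- A complement of the kernel of an intertwining map is equivalent to the range. -/
def equivRangeOfIsCompl {ρ : Representation ℂ G V} {σ : Representation ℂ G W}
    (f : ρ.IntertwiningMap σ) (T : Subrepresentation ρ)
    (hT : IsCompl f.ker.toSubmodule T.toSubmodule) :
    T.toRepresentation.Equiv f.range.toRepresentation :=
  Representation.Equiv.mk
    (LinearEquiv.ofBijective
      (f.toLinearMap.rangeRestrict.comp T.toSubmodule.subtype) (by
        constructor
        · rw [← LinearMap.ker_eq_bot, LinearMap.ker_eq_bot']
          rintro ⟨x, hx⟩ h0
          have h1 : x ∈ f.ker.toSubmodule := by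
            have := congrArg Subtype.val h0
            simpa using this
          have := (Submodule.disjoint_def.1 hT.1) x h1 hx
          exact Subtype.ext this
        · rintro ⟨_, x, rfl⟩
          have hx : x ∈ f.ker.toSubmodule ⊔ T.toSubmodule := by
            rw [codisjoint_iff.1 hT.2]; trivial
          obtain ⟨y, hy, z, hz, rfl⟩ := Submodule.mem_sup.1 hx
          refine ⟨⟨z, hz⟩, Subtype.ext ?_⟩
          have hy' : f y = 0 := hy
          simp [hy']))
    fun g => by
      ext x
      exact f.isIntertwining _ _ g x

/-- **Characters determine representations** of finite groups over `ℂ`. -/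
theorem nonempty_equiv_of_character_eq [Finite G] [FiniteDimensional ℂ V]
    [FiniteDimensional ℂ W] (ρ : Representation ℂ G V) (σ : Representation ℂ G W)
    (hχ : ρ.character = σ.character) : Nonempty (ρ.Equiv σ) := by
  classical
  cases nonempty_fintype G
  let _ : Invertible (Nat.card G : ℂ) := invertibleOfNonzero (by
    simp)
  induction hd : Module.finrank ℂ V using Nat.strong_induction_on generalizing V W with
  | _ d ih =>
  have hVW : Module.finrank ℂ V = Module.finrank ℂ W := by
    have := congrFun hχ 1
    rw [char_one, char_one] at this
    exact_mod_cast this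
  rcases Nat.eq_zero_or_pos d with h0 | h0
  · have h1 : Subsingleton V := Module.finrank_zero_iff.1 (hd.trans h0)
    have h2 : Subsingleton W := Module.finrank_zero_iff.1 (hVW.symm.trans (hd.trans h0))
    exact ⟨Representation.Equiv.mk (LinearEquiv.ofFinrankEq V W hVW)
      fun g => LinearMap.ext fun x => Subsingleton.elim _ _⟩
  -- The dimension of a Hom space depends only on the characters. Since the identity of `ρ` is
  -- nonzero, there is a nonzero map from `ρ` to `σ`.
  have hHom : Module.finrank ℂ (ρ.IntertwiningMap σ) = Module.finrank ℂ (ρ.IntertwiningMap ρ) := by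
    have h1 := card_inv_mul_sum_char_mul_char_eq_finrank ρ σ
    have h2 := card_inv_mul_sum_char_mul_char_eq_finrank ρ ρ
    rw [← hχ, h2] at h1
    exact_mod_cast h1.symm
  have hV : Nontrivial V := Module.nontrivial_of_finrank_pos (R := ℂ) (by omega)
  have hid : (IntertwiningMap.id ρ) ≠ 0 := by
    intro h
    obtain ⟨v, hv⟩ := exists_ne (0 : V)
    exact hv (by simpa using congrArg (fun f : ρ.IntertwiningMap ρ => f v) h)
  have hfin : ∀ {V W : Type _} [AddCommGroup V] [Module ℂ V] [AddCommGroup W] [Module ℂ W]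
      [FiniteDimensional ℂ V] [FiniteDimensional ℂ W] (ρ : Representation ℂ G V)
      (σ : Representation ℂ G W), FiniteDimensional ℂ (ρ.IntertwiningMap σ) := fun ρ σ =>
    (invariantsEquivIntertwiningMap ρ σ).finiteDimensional
  have hpos : 0 < Module.finrank ℂ (ρ.IntertwiningMap σ) := by
    rw [hHom]
    have := hfin ρ ρ
    exact Module.finrank_pos_iff_exists_ne_zero.2 ⟨_, hid⟩
  obtain ⟨f, hf⟩ : ∃ f : ρ.IntertwiningMap σ, f ≠ 0 := by
    by_contra! h
    have : Subsingleton (ρ.IntertwiningMap σ) := ⟨fun a b => (h a).trans (h b).symm⟩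
    rw [Module.finrank_zero_of_subsingleton] at hpos
    exact lt_irrefl _ hpos
  -- The complement of the kernel matches the range, so the kernel and the complement of the range
  -- have equal characters. As `f ≠ 0`, induction on the dimension applies to them.
  obtain ⟨T, hT⟩ := exists_isCompl_subrepresentation f.ker
  obtain ⟨R, hR⟩ := exists_isCompl_subrepresentation f.range
  have e1 := equivRangeOfIsCompl f T hT
  have hlt : Module.finrank ℂ f.ker.toSubmodule < d := by
    rw [← hd]
    apply Submodule.finrank_lt
    intro h
    apply hf
    ext v
    have : v ∈ f.ker.toSubmodule := by rw [h]; trivial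
    exact this
  have hc : f.ker.toRepresentation.character = R.toRepresentation.character := by
    have h1 := char_iso (prodEquivOfIsCompl _ _ hT)
    have h2 := char_iso (prodEquivOfIsCompl _ _ hR)
    rw [character_prod, char_iso e1] at h1
    rw [character_prod] at h2
    rw [← h2, add_comm] at hχ
    rw [← h1, add_comm] at hχ
    exact add_left_cancel (hχ.trans (add_comm _ _))
  obtain ⟨e2⟩ := ih _ hlt f.ker.toRepresentation R.toRepresentation hc rfl
  exact ⟨(prodEquivOfIsCompl _ _ hT).symm.trans ((prodEquivCongr e2 e1).trans
    ((prodEquivComm _ _).trans (prodEquivOfIsCompl _ _ hR)))⟩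

end Characters

section Induction

variable {H : Type*} [Group H] [Fintype H] {X : Type*} [AddCommGroup X] [Module ℂ X]
  [FiniteDimensional ℂ X]

/-- The trace on the coinvariants is the average of the traces. -/
theorem trace_coinvariants_map (τ : Representation ℂ H X) (T : τ.IntertwiningMap τ) :
    LinearMap.trace ℂ _ (Coinvariants.map τ τ T) =
      (Fintype.card H : ℂ)⁻¹ * ∑ h : H, LinearMap.trace ℂ X (T.toLinearMap ∘ₗ τ h) := by
  let _ : Invertible (Fintype.card H : ℂ) := invertibleOfNonzero (by simp)
  -- Averaging descends to a section `s` of the quotient map `mk`, and `s ∘ mk` is the average.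
  -- Cyclicity of the trace then moves the computation to `X`.
  let s : Coinvariants τ →ₗ[ℂ] X := Coinvariants.lift τ (averageMap τ) fun x => by
    have := GroupAlgebra.mul_average_right ℂ H x
    have h2 := congrArg (asAlgebraHom τ) this
    rw [map_mul, asAlgebraHom_single_one] at h2
    exact h2
  have hav : averageMap τ = (Fintype.card H : ℂ)⁻¹ • ∑ h : H, τ h := by
    simp [averageMap, GroupAlgebra.average]
  have h1 : Coinvariants.mk τ ∘ₗ s = LinearMap.id := by
    apply Coinvariants.hom_ext
    ext x
    have : (Fintype.card H : ℂ) ≠ 0 := by simp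
    have h2 : s (Coinvariants.mk τ x) = averageMap τ x := Coinvariants.lift_mk _ _ _ _
    rw [LinearMap.comp_apply, LinearMap.comp_apply, h2, hav]
    simp [← Nat.cast_smul_eq_nsmul ℂ, smul_smul, this]
  have h2 : s ∘ₗ Coinvariants.mk τ = averageMap τ := by
    ext x; simp [s]
  have h3 : Coinvariants.map τ τ T = Coinvariants.mk τ ∘ₗ (T.toLinearMap ∘ₗ s) := by
    calc _ = Coinvariants.map τ τ T ∘ₗ (Coinvariants.mk τ ∘ₗ s) := by rw [h1, LinearMap.comp_id]
      _ = _ := by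
        rw [← LinearMap.comp_assoc, Coinvariants.map_comp_mk, LinearMap.comp_assoc]
        rfl
  rw [h3, LinearMap.trace_comp_comm', LinearMap.comp_assoc, h2, hav, LinearMap.comp_smul, map_smul,
    smul_eq_mul]
  congr 1
  rw [← map_sum (LinearMap.trace ℂ X)]
  congr 1
  ext x
  simp

instance {G : Type*} [Finite G] : FiniteDimensional ℂ (MonoidAlgebra ℂ G) :=
  Module.Finite.equiv (MonoidAlgebra.coeffLinearEquiv ℂ).symm

variable {G : Type*} [Group G] [Fintype G] [DecidableEq G]

omit [Group G] in
theorem trace_mapDomain (σ : G → G) :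
    LinearMap.trace ℂ _ (MonoidAlgebra.mapDomainLinearMap ℂ ℂ σ) =
      ∑ x : G, if σ x = x then (1 : ℂ) else 0 := by
  have h1 : (MonoidAlgebra.mapDomainLinearMap ℂ ℂ σ) =
    (MonoidAlgebra.coeffLinearEquiv ℂ).symm.conj (Finsupp.lmapDomain ℂ ℂ σ) := rfl
  rw [h1, LinearMap.trace_conj', LinearMap.trace_eq_matrix_trace ℂ Finsupp.basisSingleOne,
    Matrix.trace]
  refine Finset.sum_congr rfl fun x _ => ?_
  simp [LinearMap.toMatrix_apply, Finsupp.single_apply]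

instance (φ : H →* G) (ρ : Representation ℂ H X) : FiniteDimensional ℂ (IndV φ ρ) :=
  Module.Finite.of_surjective (Coinvariants.mk _) (Coinvariants.mk_surjective _)

/-- The character of an induced representation, along an arbitrary homomorphism. -/
theorem character_ind (φ : H →* G) (ρ : Representation ℂ H X) (g : G) :
    (Representation.ind φ ρ).character g =
      (Fintype.card H : ℂ)⁻¹ * ∑ h : H, ρ.character h *
        ∑ x : G, if φ h * x * g⁻¹ = x then (1 : ℂ) else 0 := by
  rw [character, ind_apply, trace_coinvariants_map]
  congr 1
  refine Finset.sum_congr rfl fun h _ => ?_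
  rw [mul_comm, ← trace_mapDomain, character, ← LinearMap.trace_tensorProduct']
  congr 1
  ext x v
  simp [mul_assoc]

/-- **Frobenius reciprocity** for class functions with values in a vector space. -/
theorem sum_character_ind {M : Type*} [AddCommGroup M] [Module ℂ M] (φ : H →* G)
    (ρ : Representation ℂ H X) (F : G → M) (hF : ∀ x g, F (x⁻¹ * g * x) = F g) :
    (Fintype.card G : ℂ)⁻¹ • ∑ g : G, (Representation.ind φ ρ).character g • F g =
      (Fintype.card H : ℂ)⁻¹ • ∑ h : H, ρ.character h • F (φ h) := by
  have hG : (Fintype.card G : ℂ) ≠ 0 := by simp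
  rw [inv_smul_eq_iff₀ hG, smul_comm]
  simp_rw [character_ind, mul_smul]
  rw [← Finset.smul_sum]
  congr 1
  simp_rw [Finset.sum_smul, Finset.smul_sum]
  rw [Finset.sum_comm]
  refine Finset.sum_congr rfl fun h _ => ?_
  simp_rw [mul_smul, Finset.sum_smul]
  rw [← Finset.smul_sum, Finset.sum_comm, smul_comm]
  congr 1
  -- For fixed `h` and `x` exactly one `g` contributes, a conjugate of `φ h`, where `F` takes the
  -- value `F (φ h)`.
  have : ∀ x g : G, (φ h * x * g⁻¹ = x) ↔ (x⁻¹ * φ h * x = g) := fun x g => by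
    rw [mul_inv_eq_iff_eq_mul, mul_assoc x⁻¹, inv_mul_eq_iff_eq_mul]
  simp_rw [this]
  simp [hF, Nat.cast_smul_eq_nsmul]

end Induction

end Representations

/-! ### Power sum monomials as products over cycles. -/

section CycleMonomials

open Equiv Equiv.Perm Function

section CycleMonomial

variable {A : Type*}

theorem minimalPeriod_eq_of_sameCycle {w : Perm A} {a b : A} (h : w.SameCycle a b) :
    minimalPeriod w a = minimalPeriod w b := by
  obtain ⟨i, rfl⟩ := h
  refine minimalPeriod_eq_minimalPeriod_iff.2 fun n => ?_
  simp only [IsPeriodicPt, IsFixedPt, iterate_eq_pow]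
  rw [← Perm.mul_apply, ← zpow_natCast, (Commute.refl w).zpow_zpow n i |>.eq, Perm.mul_apply,
    EmbeddingLike.apply_eq_iff_eq]

/-- The length of the cycle of `w` given by a class of `SameCycle w`. -/
def cycleLength (w : Perm A) : Quotient (SameCycle.setoid w) → ℕ :=
  Quotient.lift (fun a => minimalPeriod w a) fun _ _ h => minimalPeriod_eq_of_sameCycle h

/-- The monomial `p_{λ(w)}`, as a product over the cycles of `w`. -/
def cycleMonomial (w : Perm A) : SymmFun :=
  ∏ᶠ q : Quotient (SameCycle.setoid w), p (cycleLength w q)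

theorem minimalPeriod_pos_of_finite [Finite A] (w : Perm A) (a : A) : 0 < minimalPeriod w a :=
  minimalPeriod_pos_of_mem_periodicPts (w.injective.mem_periodicPts a)

theorem cycleLength_pos [Finite A] (w : Perm A) (q) : 0 < cycleLength w q := by
  induction q using Quotient.inductionOn with
  | h a => exact minimalPeriod_pos_of_finite w a

theorem powerSubst_p (k : ℕ+) {n : ℕ} (hn : 0 < n) : powerSubst k (p n) = p (k * n) := by
  simp only [powerSubst, p, MvPolynomial.rename_X]
  congr 1
  apply PNat.coe_injective
  simp [Nat.toPNat'_coe, hn]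

/-- If the cycles of the permutations `g i` correspond to those of `π`, with the lengths multiplied
by `k i`, then the cycle monomial of `π` is obtained from those of the `g i`. -/
theorem cycleMonomial_eq_prod {ι : Type*} [Fintype ι] {B : ι → Type*} [∀ i, Finite (B i)]
    {X : Type*} [Finite X] (g : ∀ i, Perm (B i)) (π : Perm X) (k : ι → ℕ+) (s : ∀ i, B i → X)
    (hι : ∀ i j a b, π.SameCycle (s i a) (s j b) → i = j)
    (hs : ∀ i a b, π.SameCycle (s i a) (s i b) ↔ (g i).SameCycle a b)
    (hsurj : ∀ x, ∃ i a, π.SameCycle (s i a) x)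
    (hk : ∀ i a, minimalPeriod π (s i a) = k i * minimalPeriod (g i) a) :
    cycleMonomial π = ∏ i, powerSubst (k i) (cycleMonomial (g i)) := by
  classical
  have (i : ι) := Fintype.ofFinite (Quotient (SameCycle.setoid (g i)))
  have := Fintype.ofFinite (Quotient (SameCycle.setoid π))
  simp only [cycleMonomial, finprod_eq_prod_of_fintype, map_prod]
  rw [← Fintype.prod_sigma']
  let F : (Σ i, Quotient (SameCycle.setoid (g i))) → Quotient (SameCycle.setoid π) := fun x =>
    Quotient.lift (fun a => (Quotient.mk (SameCycle.setoid π) (s x.1 a)))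
      (fun a b h => Quotient.sound ((hs x.1 a b).2 h)) x.2
  have hF : Bijective F := by
    constructor
    · rintro ⟨i, q⟩ ⟨j, r⟩ h
      induction q using Quotient.inductionOn with
      | h a =>
      induction r using Quotient.inductionOn with
      | h b =>
      have h' : π.SameCycle (s i a) (s j b) := Quotient.exact h
      obtain rfl := hι _ _ _ _ h'
      congr 1
      exact Quotient.sound ((hs _ _ _).1 h')
    · intro q
      induction q using Quotient.inductionOn with
      | h x =>
      obtain ⟨i, a, h⟩ := hsurj x
      exact ⟨⟨i, Quotient.mk _ a⟩, Quotient.sound h⟩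
  refine (Fintype.prod_bijective F hF _ _ ?_).symm
  rintro ⟨i, q⟩
  rw [powerSubst_p _ (cycleLength_pos _ _)]
  induction q using Quotient.inductionOn with
  | h a => exact congrArg p (hk i a).symm

theorem powerSubst_one (f : SymmFun) : powerSubst 1 f = f := by
  have : (fun j : ℕ+ => 1 * j) = id := by ext; simp
  rw [powerSubst, this]
  exact MvPolynomial.rename_id_apply f

/-- Conjugate permutations have the same cycle monomial. -/
theorem cycleMonomial_congr {B : Type*} [Finite A] [Finite B] (f : A ≃ B) (w : Perm A)
    (w' : Perm B) (h : ∀ a, f (w a) = w' (f a)) : cycleMonomial w' = cycleMonomial w := by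
  have hpow : ∀ (n : ℕ) a, (w' ^ n) (f a) = f ((w ^ n) a) := fun n => by
    induction n with
    | zero => simp
    | succ n ih => intro a; rw [pow_succ', pow_succ', Perm.mul_apply, ih, Perm.mul_apply, h]
  have hs : ∀ a b, w'.SameCycle (f a) (f b) ↔ w.SameCycle a b := fun a b => by
    constructor
    · intro h
      obtain ⟨n, hn⟩ := h.exists_nat_pow_eq
      rw [hpow, f.apply_eq_iff_eq] at hn
      exact ⟨n, by simpa using hn⟩
    · intro h
      obtain ⟨n, hn⟩ := h.exists_nat_pow_eq
      exact ⟨n, by simp [hpow, hn]⟩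
  rw [cycleMonomial_eq_prod (ι := Unit) (B := fun _ => A) (fun _ => w) w' (fun _ => 1)
    (fun _ a => f a) (fun _ _ _ _ _ => rfl) (fun _ => hs)
    (fun x => ⟨(), f.symm x, by simp [SameCycle.refl]⟩)]
  · simp [powerSubst_one]
  · intro _ a
    rw [PNat.one_coe, one_mul]
    refine minimalPeriod_eq_minimalPeriod_iff.2 fun n => ?_
    simp [IsPeriodicPt, IsFixedPt, iterate_eq_pow, hpow]

theorem sumCongr_pow {B : Type*} (v : Perm A) (w : Perm B) (n : ℕ) :
    (Equiv.Perm.sumCongr v w) ^ n = Equiv.Perm.sumCongr (v ^ n) (w ^ n) :=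
  (map_pow (Equiv.Perm.sumCongrHom A B) (v, w) n).symm

theorem cycleMonomial_sumCongr {A B : Type} [Finite A] [Finite B] (v : Perm A) (w : Perm B) :
    cycleMonomial (Equiv.Perm.sumCongr v w) = cycleMonomial v * cycleMonomial w := by
  let C : Bool → Type := fun b => bif b then A else B
  have : ∀ b, Finite (C b) := fun b => by cases b <;> assumption
  let g : ∀ b, Perm (C b) := fun b => match b with
    | true => v
    | false => w
  let s : ∀ b, C b → A ⊕ B := fun b => match b with
    | true => Sum.inl
    | false => Sum.inr
  have hpow : ∀ (n : ℕ) b a, ((Equiv.Perm.sumCongr v w) ^ n) (s b a) = s b ((g b ^ n) a) := by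
    intro n b a
    rw [sumCongr_pow]
    cases b <;> rfl
  have hinj : ∀ b, Injective (s b) := by
    intro b
    cases b
    · exact Sum.inr_injective
    · exact Sum.inl_injective
  rw [cycleMonomial_eq_prod g (Equiv.Perm.sumCongr v w) (fun _ => 1) s]
  · rw [Fintype.prod_bool]
    simp only [powerSubst_one]
    rfl
  · intro i j a b h
    obtain ⟨n, hn⟩ := h.exists_nat_pow_eq
    rw [hpow] at hn
    cases i <;> cases j <;> first | rfl | cases hn
  · intro i a b
    constructor <;> intro h <;> obtain ⟨n, hn⟩ := h.exists_nat_pow_eq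
    · rw [hpow] at hn
      exact ⟨n, by simpa using hinj i hn⟩
    · exact ⟨n, by simp [hpow, hn]⟩
  · rintro (a | b)
    · exact ⟨true, a, SameCycle.refl _ _⟩
    · exact ⟨false, b, SameCycle.refl _ _⟩
  · intro i a
    rw [PNat.one_coe, one_mul]
    refine minimalPeriod_eq_minimalPeriod_iff.2 fun n => ?_
    simp only [IsPeriodicPt, IsFixedPt, iterate_eq_pow, hpow, (hinj i).eq_iff]

theorem cycleLength_eq_out (w : Perm A) (q : Quotient (SameCycle.setoid w)) :
    cycleLength w q = minimalPeriod w q.out := by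
  conv_lhs => rw [← Quotient.out_eq q]
  rfl

theorem card_support_cycleOf [Fintype A] [DecidableEq A] {w : Perm A} {a : A} (ha : w a ≠ a) :
    (w.cycleOf a).support.card = minimalPeriod w a := by
  have hc := isCycle_cycleOf w ha
  have ha' : w.cycleOf a a ≠ a := by simpa using ha
  rw [← hc.orderOf]
  refine Nat.dvd_antisymm ?_ ?_
  · rw [orderOf_dvd_iff_pow_eq_one, hc.pow_eq_one_iff' ha', cycleOf_pow_apply_self,
      ← iterate_eq_pow]
    exact iterate_minimalPeriod
  · rw [← isPeriodicPt_iff_minimalPeriod_dvd, IsPeriodicPt, IsFixedPt, iterate_eq_pow,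
      ← cycleOf_pow_apply_self, pow_orderOf_eq_one, Perm.one_apply]

/-- `Equiv.Perm.partition` joins the lengths of the nontrivial cycles to a block of ones for the
fixed points. The classes of `SameCycle` split in the same way, the nontrivial ones matching the
cycle factors through `cycleOf`. -/
theorem pPart_partition [Fintype A] [DecidableEq A] (w : Perm A) :
    pPart w.partition = cycleMonomial w := by
  classical
  have := Fintype.ofFinite (Quotient (SameCycle.setoid w))
  rw [cycleMonomial, finprod_eq_prod_of_fintype, pPart, parts_partition, Multiset.map_add,
    Multiset.prod_add, cycleType_def, Multiset.map_map,
    ← Finset.prod_filter_mul_prod_filter_not (s := Finset.univ) (p := fun q => cycleLength w q ≠ 1)]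
  have hne : ∀ q, cycleLength w q ≠ 1 ↔ w q.out ≠ q.out := fun q => by
    rw [cycleLength_eq_out, ne_eq, minimalPeriod_eq_one_iff_isFixedPt, IsFixedPt]
  congr 1
  · symm
    refine Finset.prod_bij (fun q _ => w.cycleOf q.out) ?_ ?_ ?_ ?_
    · intro q hq
      rw [Finset.mem_filter, hne] at hq
      rw [cycleOf_mem_cycleFactorsFinset_iff, Perm.mem_support]
      exact hq.2
    · intro q hq r hr h
      rw [Finset.mem_filter, hne] at hq hr
      rw [← Quotient.out_eq q, ← Quotient.out_eq r]
      exact Quotient.sound ((sameCycle_iff_cycleOf_eq_of_mem_support (Perm.mem_support.2 hq.2)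
        (Perm.mem_support.2 hr.2)).2 h)
    · intro c hc
      obtain ⟨a, ha⟩ := (mem_cycleFactorsFinset_iff.1 hc).1.nonempty_support
      have hwa : w a ≠ a := Perm.mem_support.1 (mem_cycleFactorsFinset_support_le hc ha)
      have hsc : w.SameCycle (Quotient.mk (SameCycle.setoid w) a).out a := Quotient.mk_out (s := SameCycle.setoid w) a
      refine ⟨Quotient.mk _ a, ?_, ?_⟩
      · rw [Finset.mem_filter]
        refine ⟨Finset.mem_univ _, ?_⟩
        change minimalPeriod w a ≠ 1
        rwa [ne_eq, minimalPeriod_eq_one_iff_isFixedPt]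
      · rw [hsc.cycleOf_eq, cycle_is_cycleOf ha hc]
    · intro q hq
      rw [Finset.mem_filter, hne] at hq
      rw [comp_apply, comp_apply, card_support_cycleOf hq.2, cycleLength_eq_out]
  · rw [Multiset.map_replicate, Multiset.prod_replicate,
      Finset.prod_congr rfl (g := fun _ => p 1) (fun q hq => by
        have := (Finset.mem_filter.1 hq).2
        rw [not_not.1 this]), Finset.prod_const, ← Finset.card_compl]
    congr 1
    refine Finset.card_bij (fun a _ => Quotient.mk _ a) ?_ ?_ ?_
    · intro a ha
      rw [Finset.mem_compl, Perm.mem_support, not_not] at ha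
      rw [Finset.mem_filter, not_not]
      exact ⟨Finset.mem_univ _, minimalPeriod_eq_one_iff_isFixedPt.2 ha⟩
    · intro a ha b hb h
      rw [Finset.mem_compl, Perm.mem_support, not_not] at ha
      obtain ⟨i, hi⟩ : w.SameCycle a b := Quotient.exact h
      rw [← hi, zpow_apply_eq_self_of_apply_eq_self ha]
    · intro q hq
      rw [Finset.mem_filter, hne, not_not] at hq
      exact ⟨q.out, by simpa using hq.2, Quotient.out_eq q⟩

end CycleMonomial

end CycleMonomials

/-! ### The Frobenius characteristic: injectivity, restriction and induction. -/

section FrobeniusCharacteristic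

open Equiv Equiv.Perm

theorem ch_eq_smul (n : ℕ) (f : Perm (Fin n) → ℂ) :
    ch n f = (n.factorial : ℂ)⁻¹ • ∑ w : Perm (Fin n), f w • pPart w.partition := by
  simp only [ch, MvPolynomial.smul_eq_C_mul]

theorem ch_add (n : ℕ) (f g : Perm (Fin n) → ℂ) : ch n (f + g) = ch n f + ch n g := by
  simp only [ch_eq_smul, Pi.add_apply, add_smul, Finset.sum_add_distrib, smul_add]

theorem pPart_eq_monomial {n : ℕ} (μ : n.Partition) :
    pPart μ = MvPolynomial.monomial (Multiset.toFinsupp (μ.parts.map Nat.toPNat')) 1 := by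
  rw [pPart]
  induction μ.parts using Multiset.induction with
  | empty => simp
  | cons a s ih =>
    rw [Multiset.map_cons, Multiset.prod_cons, ih, p, MvPolynomial.X, MvPolynomial.monomial_mul,
      mul_one, Multiset.map_cons, ← Multiset.singleton_add, Multiset.toFinsupp_add,
      Multiset.toFinsupp_singleton]

/-- `Nat.toPNat'` sends both 0 and 1 to 1, but parts are positive, so nothing is lost. -/
theorem map_toPNat'_injective {n : ℕ} {μ ν : n.Partition}
    (h : μ.parts.map Nat.toPNat' = ν.parts.map Nat.toPNat') : μ = ν := by
  have key : ∀ μ : n.Partition, (μ.parts.map Nat.toPNat').map PNat.val = μ.parts := fun μ => by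
    rw [Multiset.map_map]
    conv_rhs => rw [← Multiset.map_id μ.parts]
    refine Multiset.map_congr rfl fun a ha => ?_
    have := μ.parts_pos ha
    simp [Nat.toPNat'_coe, this]
  ext1
  rw [← key μ, h, key ν]

/-- A class function is determined by its Frobenius characteristic. -/
theorem ch_injective {n : ℕ} {f g : Perm (Fin n) → ℂ} (hf : ∀ v w, f (v * w * v⁻¹) = f w)
    (hg : ∀ v w, g (v * w * v⁻¹) = g w) (h : ch n f = ch n g) : f = g := by
  classical
  have hn : (n.factorial : ℂ)⁻¹ ≠ 0 := inv_ne_zero (by exact_mod_cast n.factorial_ne_zero)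
  rw [ch_eq_smul, ch_eq_smul, smul_right_inj hn] at h
  funext w
  -- Distinct partitions give distinct monomials, so this coefficient collects exactly the conjugacy
  -- class of `w`.
  have key : ∀ f : Perm (Fin n) → ℂ, (∀ v w, f (v * w * v⁻¹) = f w) →
      (∑ v : Perm (Fin n), f v • pPart v.partition).coeff
        (Multiset.toFinsupp (w.partition.parts.map Nat.toPNat')) =
      (Finset.univ.filter fun v : Perm (Fin n) => v.partition = w.partition).card * f w := by
    intro f hf
    rw [MvPolynomial.coeff_sum, ← nsmul_eq_mul, ← Finset.sum_const, Finset.sum_filter]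
    refine Finset.sum_congr rfl fun v _ => ?_
    rw [MvPolynomial.coeff_smul, pPart_eq_monomial, MvPolynomial.coeff_monomial]
    by_cases hv : v.partition = w.partition
    · obtain ⟨c, hc⟩ := isConj_iff.1 (partition_eq_of_isConj.2 hv)
      rw [if_pos hv, if_pos (by rw [hv]), ← hc, hf, smul_eq_mul, mul_one]
    · rw [if_neg hv, if_neg fun h => hv (map_toPNat'_injective (Multiset.toFinsupp.injective h)),
        smul_zero]
  have h2 := congrArg (MvPolynomial.coeff
    (Multiset.toFinsupp (w.partition.parts.map Nat.toPNat'))) h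
  rw [key f hf, key g hg] at h2
  refine mul_left_cancel₀ ?_ h2
  rw [Nat.cast_ne_zero, Finset.card_ne_zero]
  exact ⟨w, by simp⟩

/-- The derivation `∂ / ∂p₁` of the ring of symmetric functions. -/
def dp : Derivation ℂ SymmFun SymmFun := MvPolynomial.pderiv 1

theorem dp_p_one : dp (p 1) = 1 := by
  have : Nat.toPNat' 1 = 1 := rfl
  simp [dp, p, this]

theorem dp_p_of_two_le {k : ℕ} (hk : 2 ≤ k) : dp (p k) = 0 := by
  rw [dp, p, MvPolynomial.pderiv_X_of_ne]
  intro h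
  have := congrArg PNat.val h
  rw [Nat.toPNat'_coe, if_pos (by omega)] at this
  simp at this
  omega

theorem dp_prod_cycleType {n : ℕ} (w : Perm (Fin n)) : dp ((w.cycleType.map p).prod) = 0 := by
  have : ∀ k ∈ w.cycleType, 2 ≤ k := fun k hk => two_le_of_mem_cycleType hk
  revert this
  induction w.cycleType using Multiset.induction with
  | empty => simp
  | cons a s ih =>
    intro this
    rw [Multiset.map_cons, Multiset.prod_cons, Derivation.leibniz,
      ih fun k hk => this k (Multiset.mem_cons_of_mem hk),
      dp_p_of_two_le (this a (Multiset.mem_cons_self a s)), smul_zero, smul_zero, add_zero]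

theorem pPart_partition_eq {n : ℕ} (w : Perm (Fin n)) :
    pPart w.partition = (w.cycleType.map p).prod * p 1 ^ (n - w.support.card) := by
  rw [pPart, parts_partition, Multiset.map_add, Multiset.prod_add, Multiset.map_replicate,
    Multiset.prod_replicate, Fintype.card_fin]

/-- The cycle monomial of `w` with one fixed point removed. -/
def removeFixed {n : ℕ} (w : Perm (Fin n)) : SymmFun :=
  (w.cycleType.map p).prod * p 1 ^ (n - w.support.card - 1)

theorem removeFixed_conj {n : ℕ} (v w : Perm (Fin n)) :
    removeFixed (v * w * v⁻¹) = removeFixed w := by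
  rw [removeFixed, cycleType_conj, card_support_conj, removeFixed]

/-- The exponent of `p 1` is the number of fixed letters. Writing that number as a sum over letters
prepares the exchange of sums in `dp_ch`. Without fixed letters the truncated exponent in
`removeFixed` is harmless, since no term survives. -/
theorem dp_pPart {n : ℕ} (w : Perm (Fin n)) :
    dp (pPart w.partition) = ∑ a : Fin n, if w a = a then removeFixed w else 0 := by
  rw [pPart_partition_eq, Derivation.leibniz, dp_prod_cycleType, smul_zero, add_zero,
    Derivation.leibniz_pow, dp_p_one, ← Finset.sum_filter, Finset.sum_const, removeFixed]
  have : (Finset.univ.filter fun a => w a = a).card = n - w.support.card := by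
    have h1 : (Finset.univ.filter fun a => w a = a) = w.supportᶜ := by
      ext a
      simp
    rw [h1, Finset.card_compl, Fintype.card_fin]
  rw [this, smul_eq_mul, smul_eq_mul, mul_one, mul_smul_comm]

theorem dp_pPart_of_forall_ne {n : ℕ} (w : Perm (Fin n)) (hw : ∀ a, w a ≠ a) :
    dp (pPart w.partition) = 0 := by
  rw [dp_pPart]
  exact Finset.sum_eq_zero fun a _ => if_neg (hw a)

theorem cycleType_incl {m n : ℕ} (h : m ≤ n) (w : Perm (Fin m)) :
    (incl h w).cycleType = w.cycleType := by
  classical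
  rw [incl, viaEmbeddingHom_apply, viaEmbedding]
  convert cycleType_extendDomain (Equiv.ofInjective (Fin.castLEEmb h).1 (Fin.castLEEmb h).2)

theorem card_support_incl {m n : ℕ} (h : m ≤ n) (w : Perm (Fin m)) :
    (incl h w).support.card = w.support.card := by
  rw [← sum_cycleType, cycleType_incl, sum_cycleType]

theorem removeFixed_incl {n : ℕ} (w : Perm (Fin n)) :
    removeFixed (incl (Nat.le_succ n) w) = pPart w.partition := by
  rw [removeFixed, cycleType_incl, card_support_incl, pPart_partition_eq]
  congr 2
  have := w.support.card_le_univ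
  rw [Fintype.card_fin] at this
  omega

theorem pPart_incl {n : ℕ} (w : Perm (Fin n)) :
    pPart (incl (Nat.le_succ n) w).partition = p 1 * pPart w.partition := by
  rw [pPart_partition_eq, cycleType_incl, card_support_incl, pPart_partition_eq]
  have := w.support.card_le_univ
  rw [Fintype.card_fin] at this
  rw [Nat.succ_sub this, pow_succ]
  ring

theorem incl_castSucc {n : ℕ} (w : Perm (Fin n)) (a : Fin n) :
    incl (Nat.le_succ n) w a.castSucc = (w a).castSucc :=
  viaEmbedding_apply w (Fin.castLEEmb (Nat.le_succ n)) a

theorem incl_last {n : ℕ} (w : Perm (Fin n)) :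
    incl (Nat.le_succ n) w (Fin.last n) = Fin.last n := by
  refine viaEmbedding_apply_of_notMem w (Fin.castLEEmb (Nat.le_succ n)) _ ?_
  rintro ⟨a, ha⟩
  exact absurd (congrArg Fin.val ha) a.2.ne

theorem incl_injective {m n : ℕ} (h : m ≤ n) : Function.Injective (incl h) :=
  viaEmbeddingHom_injective _

/-- The image of `S_n` in `S_{n+1}` is the stabilizer of the last letter. -/
theorem exists_incl_eq {n : ℕ} (w : Perm (Fin (n + 1))) (hw : w (Fin.last n) = Fin.last n) :
    ∃ v, incl (Nat.le_succ n) v = w := by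
  have h1 : ∀ u : Perm (Fin (n + 1)), u (Fin.last n) = Fin.last n → ∀ a : Fin n,
      u a.castSucc ≠ Fin.last n := fun u hu a h =>
    (Fin.castSucc_lt_last a).ne (u.injective (h.trans hu.symm))
  have h2 : w⁻¹ (Fin.last n) = Fin.last n := by
    rw [Perm.inv_eq_iff_eq, hw]
  refine ⟨⟨fun a => (w a.castSucc).castPred (h1 w hw a),
    fun a => (w⁻¹ a.castSucc).castPred (h1 _ h2 a), fun a => ?_, fun a => ?_⟩, ?_⟩
  · simp
  · simp
  · ext a
    induction a using Fin.lastCases with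
    | last => rw [incl_last, hw]
    | cast a => rw [incl_castSucc]; simp

theorem sum_filter_fix_last {n : ℕ} {M : Type*} [AddCommMonoid M] (F : Perm (Fin (n + 1)) → M) :
    ∑ w : Perm (Fin (n + 1)), (if w (Fin.last n) = Fin.last n then F w else 0) =
      ∑ v : Perm (Fin n), F (incl (Nat.le_succ n) v) := by
  classical
  rw [← Finset.sum_filter]
  symm
  refine Finset.sum_bij (fun v _ => incl (Nat.le_succ n) v) ?_ ?_ ?_ ?_
  · intro v _
    simp [incl_last]
  · intro v _ w _ h
    exact incl_injective _ h
  · intro w hw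
    obtain ⟨v, hv⟩ := exists_incl_eq w (by simpa using hw)
    exact ⟨v, Finset.mem_univ _, hv⟩
  · intro v _
    rfl

/-- Restriction to `S_n` corresponds to `∂ / ∂p₁`. -/
theorem dp_ch {n : ℕ} (f : Perm (Fin (n + 1)) → ℂ) (hf : ∀ v w, f (v * w * v⁻¹) = f w) :
    dp (ch (n + 1) f) = ch n fun w => f (incl (Nat.le_succ n) w) := by
  rw [ch_eq_smul, ch_eq_smul, Derivation.map_smul, map_sum]
  simp only [Derivation.map_smul, dp_pPart, Finset.smul_sum]
  rw [Finset.sum_comm]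
  simp only [← Finset.smul_sum]
  -- Conjugation by the transposition of `a` and the last letter shows that every letter contributes
  -- as much as the last one, whose stabilizer is $S_n$. The resulting factor $n+1$ turns $1/(n+1)!$
  -- into $1/n!$.
  have h1 : ∀ a : Fin (n + 1), (∑ w : Perm (Fin (n + 1)),
      f w • (if w a = a then removeFixed w else 0)) =
      ∑ v : Perm (Fin n), f (incl (Nat.le_succ n) v) • pPart v.partition := by
    intro a
    rw [← Equiv.sum_comp (MulAut.conj (swap a (Fin.last n))).toEquiv]
    have h2 : ∀ w : Perm (Fin (n + 1)),
        f ((MulAut.conj (swap a (Fin.last n))).toEquiv w) •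
          (if (MulAut.conj (swap a (Fin.last n))).toEquiv w a = a then
            removeFixed ((MulAut.conj (swap a (Fin.last n))).toEquiv w) else 0) =
        if w (Fin.last n) = Fin.last n then f w • removeFixed w else 0 := by
      intro w
      have h3 : (MulAut.conj (swap a (Fin.last n))).toEquiv w =
        swap a (Fin.last n) * w * (swap a (Fin.last n))⁻¹ := rfl
      rw [h3, hf, removeFixed_conj]
      have h4 : (swap a (Fin.last n) * w * (swap a (Fin.last n))⁻¹) a = a ↔
          w (Fin.last n) = Fin.last n := by
        rw [swap_inv, Perm.mul_apply, Perm.mul_apply, swap_apply_left,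
          Equiv.swap_apply_eq_iff, swap_apply_left]
      simp only [h4, smul_ite, smul_zero]
    rw [Finset.sum_congr rfl fun w _ => h2 w, sum_filter_fix_last]
    simp only [removeFixed_incl]
  rw [Finset.sum_congr rfl fun a _ => h1 a, Finset.sum_const, Finset.card_univ, Fintype.card_fin,
    ← Nat.cast_smul_eq_nsmul ℂ, smul_smul]
  congr 1
  rw [Nat.factorial_succ]
  have : (n.factorial : ℂ) ≠ 0 := by exact_mod_cast n.factorial_ne_zero
  have : ((n + 1 : ℕ) : ℂ) ≠ 0 := by exact_mod_cast n.succ_ne_zero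
  push_cast at *
  field_simp

theorem card_perm_fin (n : ℕ) : Fintype.card (Perm (Fin n)) = n.factorial := by
  rw [Fintype.card_perm, Fintype.card_fin]

variable {H : Type*} [Group H] [Fintype H] {V : Type*} [AddCommGroup V] [Module ℂ V]
  [FiniteDimensional ℂ V]

/-- Frobenius reciprocity for the class function $w\mapsto f(w)p_{\lambda(w)}$. The factor `f` lets
$\ell_n$ and its sign twist $\pi_n$ be treated together. -/
theorem ch_mul_character_ind {n : ℕ} (φ : H →* Perm (Fin n)) (ρ : Representation ℂ H V)
    (f : Perm (Fin n) → ℂ) (hf : ∀ v w, f (v * w * v⁻¹) = f w) :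
    (ch n fun w => f w * (Representation.ind φ ρ).character w) =
      (Fintype.card H : ℂ)⁻¹ • ∑ h : H, (f (φ h) * ρ.character h) • pPart (φ h).partition := by
  have := sum_character_ind φ ρ (fun w => f w • pPart w.partition) fun x g => by
    have h1 := hf x⁻¹ g
    have h2 : (x⁻¹ * g * x⁻¹⁻¹).partition = g.partition :=
      (partition_eq_of_isConj.1 (isConj_iff.2 ⟨x⁻¹, rfl⟩)).symm
    rw [inv_inv] at h1 h2
    rw [h1, h2]
  rw [ch_eq_smul]
  rw [card_perm_fin] at this
  simp only [smul_smul] at this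
  simp only [mul_comm (f _), this]

theorem ch_character_ind {n : ℕ} (φ : H →* Perm (Fin n)) (ρ : Representation ℂ H V) :
    ch n (Representation.ind φ ρ).character =
      (Fintype.card H : ℂ)⁻¹ • ∑ h : H, ρ.character h • pPart (φ h).partition := by
  simpa using ch_mul_character_ind φ ρ (fun _ => 1) fun _ _ => rfl

/-- Induction from `S_n` to `S_{n+1}` corresponds to multiplication by `p₁`. -/
theorem ch_character_ind_incl {n : ℕ} (ρ : Representation ℂ (Perm (Fin n)) V) :
    ch (n + 1) (ind (n + 1) ρ).character = p 1 * ch n ρ.character := by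
  rw [ind]
  change ch (n + 1) (Representation.ind (incl (Nat.le_succ n)) ρ).character = _
  rw [ch_character_ind, ch_eq_smul, mul_smul_comm, Finset.mul_sum, card_perm_fin]
  simp only [pPart_incl, mul_smul_comm]

end FrobeniusCharacteristic

/-! ### The differential recurrence for the Frobenius images. -/

section Recurrences

open Equiv Equiv.Perm

section LieCharacter

theorem sgn_conj {n : ℕ} (v w : Perm (Fin n)) : sgn (v * w * v⁻¹) = sgn w := by
  simp only [sgn, Perm.sign_mul, sign_inv]
  rw [mul_right_comm, Int.units_mul_self, one_mul]

theorem sgn_incl {m n : ℕ} (h : m ≤ n) (w : Perm (Fin m)) : sgn (incl h w) = sgn w := by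
  simp only [sgn, sign_of_cycleType, cycleType_incl]

theorem card_cyc {n : ℕ} (hn : n ≠ 0) : Nat.card (cyc n) = n := by
  rw [Nat.card_zpowers]
  obtain _ | _ | n := n
  · exact absurd rfl hn
  · rw [orderOf_eq_one_iff]
    exact Equiv.ext fun x => Subsingleton.elim (α := Fin 1) _ _
  · rw [isCycle_finRotate.orderOf, support_finRotate, Finset.card_univ, Fintype.card_fin]

/-- A power of a cycle that fixes a letter of its support is trivial, and an $n$-cycle with $n\ge2$
moves every letter. For $n=0$ there is no letter, for $n=1$ no nontrivial element. -/
theorem cyc_apply_ne {n : ℕ} (w : cyc n) (hw : w ≠ 1) (a : Fin n) : (w : Perm (Fin n)) a ≠ a := by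
  obtain ⟨w, k, rfl⟩ := w
  obtain _ | _ | n := n
  · exact a.elim0
  · exact absurd (Subtype.ext (Equiv.ext fun x => Subsingleton.elim (α := Fin 1) _ _)) hw
  · intro ha
    apply hw
    ext1
    have hc : IsCycle (finRotate (n + 2)) := isCycle_finRotate
    have ha' : finRotate (n + 2) a ≠ a := by
      rw [← Perm.mem_support, support_finRotate]
      exact Finset.mem_univ a
    obtain ⟨j, hj⟩ : ∃ j : ℕ, (finRotate (n + 2)) ^ j = (finRotate (n + 2)) ^ k :=
      (isOfFinOrder_of_finite _).mem_powers_iff_mem_zpowers.2 ⟨k, rfl⟩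
    change (finRotate (n + 2)) ^ k = 1
    change ((finRotate (n + 2)) ^ k) a = a at ha
    rw [← hj] at ha ⊢
    exact (hc.pow_eq_one_iff' ha').2 ha

/-- By freeness only the identity of $C_n$ contributes, with $\frac1n\,\partial p_1^n$. -/
theorem dp_ch_mul_lie {n : ℕ} (hn : n ≠ 0) (f : Perm (Fin n) → ℂ)
    (hf : ∀ v w, f (v * w * v⁻¹) = f w) (h1 : f 1 = 1) :
    dp (ch n fun w => f w * (lieRep n).character w) = p 1 ^ (n - 1) := by
  classical
  have := Fintype.ofFinite (cyc n)
  rw [lieRep, ch_mul_character_ind _ _ f hf, Derivation.map_smul, map_sum, Finset.sum_eq_single 1]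
  · rw [map_one, h1, Representation.char_one, Module.finrank_self, one_mul, Nat.cast_one, one_smul,
      pPart_partition_eq, cycleType_one, support_one, Multiset.map_zero, Multiset.prod_zero, one_mul,
      Finset.card_empty, Nat.sub_zero, Derivation.leibniz_pow, dp_p_one, ← Nat.card_eq_fintype_card,
      card_cyc hn, smul_eq_mul, mul_one, ← Nat.cast_smul_eq_nsmul ℂ, smul_smul,
      inv_mul_cancel₀ (Nat.cast_ne_zero.2 hn), one_smul]
  · intro w _ hw
    rw [Derivation.map_smul, Subgroup.coe_subtype, dp_pPart_of_forall_ne _ (cyc_apply_ne w hw),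
      smul_zero]
  · intro h
    exact absurd (Finset.mem_univ _) h

theorem dp_ell {n : ℕ} (hn : n ≠ 0) : dp (ell n) = p 1 ^ (n - 1) := by
  simpa [ell] using dp_ch_mul_lie hn (fun _ => 1) (fun _ _ => rfl) rfl

theorem dp_piSymm {n : ℕ} (hn : n ≠ 0) : dp (piSymm n) = p 1 ^ (n - 1) :=
  dp_ch_mul_lie hn sgn sgn_conj (by simp [sgn])

end LieCharacter

section Plethysm

theorem dp_h_succ (m : ℕ) : dp (h (m + 1)) = h m := dp_ch _ fun _ _ => rfl

theorem dp_e_succ (m : ℕ) : dp (e (m + 1)) = e m := by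
  rw [e, dp_ch _ sgn_conj, e]
  simp only [sgn_incl]

theorem ch_zero (f : Perm (Fin 0) → ℂ) : ch 0 f = MvPolynomial.C (f 1) := by
  rw [ch_eq_smul, Fintype.sum_unique, pPart_partition_eq]
  simp [MvPolynomial.smul_eq_C_mul, Subsingleton.elim (default : Perm (Fin 0)) 1]

theorem plethysm_h_zero (g : SymmFun) : plethysm (h 0) g = 1 := by
  simp [plethysm, h, ch_zero]

theorem plethysm_e_zero (g : SymmFun) : plethysm (e 0) g = 1 := by
  simp [plethysm, e, ch_zero, sgn]

/-- Only variables $p_{kj}$ with $kj\ge2$ occur in the image. -/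
theorem dp_powerSubst {k : ℕ+} (hk : k ≠ 1) (g : SymmFun) : dp (powerSubst k g) = 0 := by
  induction g using MvPolynomial.induction_on with
  | C a => simp [powerSubst, dp]
  | add f g hf hg => rw [map_add, map_add, hf, hg, add_zero]
  | mul_X f j hf =>
    have hkj : k * j ≠ 1 := fun h => hk (by
      have := congrArg PNat.val h
      rw [PNat.mul_coe] at this
      exact PNat.coe_injective (Nat.eq_one_of_mul_eq_one_right this))
    have hX : dp (powerSubst k (MvPolynomial.X j)) = 0 := by
      rw [powerSubst, MvPolynomial.rename_X, dp, MvPolynomial.pderiv_X_of_ne hkj]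
    rw [map_mul, Derivation.leibniz, hf, hX, smul_zero, smul_zero, add_zero]

/-- The chain rule for `∂ / ∂p₁` and plethysm. -/
theorem dp_plethysm (f g : SymmFun) : dp (plethysm f g) = plethysm (dp f) g * dp g := by
  simp only [plethysm]
  induction f using MvPolynomial.induction_on with
  | C a => simp [dp]
  | add f f' hf hf' => simp only [map_add, hf, hf', add_mul]
  | mul_X f k hf =>
    rw [map_mul, Derivation.leibniz, hf, MvPolynomial.aeval_X, Derivation.leibniz]
    by_cases hk : k = 1
    · subst hk
      have : dp (MvPolynomial.X 1) = 1 := by simp [dp]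
      rw [this, powerSubst_one]
      simp only [smul_eq_mul, map_add, map_mul, map_one, MvPolynomial.aeval_X, powerSubst_one]
      ring
    · rw [dp_powerSubst hk, dp, MvPolynomial.pderiv_X_of_ne hk]
      simp only [smul_eq_mul, map_mul, mul_zero, zero_add, MvPolynomial.aeval_X]
      ring

end Plethysm

section Recurrence

/-- The parts of the partitions in `hatPartitions n i`. -/
def hatParts (n i : ℕ) : Finset (Multiset ℕ) := (hatPartitions n i).image Nat.Partition.parts

theorem mem_hatParts {n i : ℕ} {s : Multiset ℕ} :
    s ∈ hatParts n i ↔ (∀ k ∈ s, 2 ≤ k) ∧ s.sum = n ∧ (s.map fun k => k - 1).sum = i := by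
  simp only [hatParts, hatPartitions, Finset.mem_image, Finset.mem_filter, Finset.mem_univ,
    true_and]
  constructor
  · rintro ⟨μ, ⟨h1, hr⟩, rfl⟩
    refine ⟨fun k hk => ?_, μ.parts_sum, hr⟩
    have := μ.parts_pos hk
    have : k ≠ 1 := fun h => h1 (h ▸ hk)
    omega
  · rintro ⟨h1, h2, h3⟩
    exact ⟨⟨s, fun {k} hk => by have := h1 k hk; omega, h2⟩,
      ⟨fun h => absurd (h1 1 h) (by norm_num), h3⟩, rfl⟩

theorem sum_hatPartitions {M : Type*} [AddCommMonoid M] (n i : ℕ) (F : Multiset ℕ → M) :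
    ∑ μ ∈ hatPartitions n i, F μ.parts = ∑ s ∈ hatParts n i, F s := by
  rw [hatParts, Finset.sum_image]
  intro μ _ ν _ h
  exact Nat.Partition.ext h

/-- The product `∏ G j m_j` over the distinct elements `j` of a multiset with multiplicity `m_j`. -/
def multProd (G : ℕ → ℕ → SymmFun) (s : Multiset ℕ) : SymmFun :=
  ∏ j ∈ s.toFinset, G j (s.count j)

/-- By `h0` the product may run over the support of `s` even when the erased copy of `j` was the
last one. -/
theorem multProd_erase {G : ℕ → ℕ → SymmFun} (h0 : ∀ j, G j 0 = 1) {s : Multiset ℕ} {j : ℕ}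
    (hj : j ∈ s) : multProd G (s.erase j) =
      (∏ i ∈ s.toFinset.erase j, G i (s.count i)) * G j (s.count j - 1) := by
  have h1 : multProd G (s.erase j) = ∏ i ∈ s.toFinset, G i ((s.erase j).count i) := by
    refine Finset.prod_subset (fun i hi => ?_) fun i _ hi => ?_
    · rw [Multiset.mem_toFinset] at hi ⊢
      exact Multiset.mem_of_mem_erase hi
    · rw [Multiset.mem_toFinset] at hi
      rw [Multiset.count_eq_zero.2 hi, h0]
  rw [h1, ← Finset.prod_erase_mul _ _ (Multiset.mem_toFinset.2 hj), Multiset.count_erase_self]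
  congr 1
  refine Finset.prod_congr rfl fun i hi => ?_
  rw [Multiset.count_erase_of_ne (Finset.ne_of_mem_erase hi)]

theorem derivation_prod {R A ι : Type*} [CommRing R] [CommRing A] [Algebra R A] [DecidableEq ι]
    (D : Derivation R A A) (s : Finset ι) (f : ι → A) :
    D (∏ i ∈ s, f i) = ∑ j ∈ s, (∏ i ∈ s.erase j, f i) * D (f j) := by
  induction s using Finset.induction_on with
  | empty => simp
  | insert a s ha ih =>
    rw [Finset.prod_insert ha, Derivation.leibniz, ih, Finset.sum_insert ha,
      Finset.erase_insert ha, smul_eq_mul, smul_eq_mul, add_comm, Finset.mul_sum]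
    congr 1
    refine Finset.sum_congr rfl fun j hj => ?_
    have : j ≠ a := fun h => ha (h ▸ hj)
    rw [Finset.erase_insert_of_ne this.symm, Finset.prod_insert fun h => ha (Finset.mem_of_mem_erase h)]
    ring

/-- By the Leibniz rule, differentiating the factor of `j` deletes one copy of `j`. The conditions
`h0` and `h1` are all that is needed of the factors, so the Lie and Whitney cases share one
argument. -/
theorem dp_multProd {G : ℕ → ℕ → SymmFun} (h0 : ∀ j, G j 0 = 1)
    (h1 : ∀ j m, j ≠ 0 → dp (G j (m + 1)) = G j m * p 1 ^ (j - 1)) {s : Multiset ℕ}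
    (hs : ∀ k ∈ s, 2 ≤ k) :
    dp (multProd G s) = ∑ j ∈ s.toFinset, p 1 ^ (j - 1) * multProd G (s.erase j) := by
  rw [multProd, derivation_prod]
  refine Finset.sum_congr rfl fun j hj => ?_
  rw [Multiset.mem_toFinset] at hj
  obtain ⟨m, hm⟩ := Nat.exists_eq_succ_of_ne_zero (Multiset.count_ne_zero.2 hj)
  rw [multProd_erase h0 hj, hm, h1 j m (by have := hs j hj; omega), Nat.succ_sub_one]
  ring

theorem mem_hatParts_cons {n i j : ℕ} {s : Multiset ℕ} :
    j ::ₘ s ∈ hatParts n i ↔ 2 ≤ j ∧ (∀ k ∈ s, 2 ≤ k) ∧ j + s.sum = n ∧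
      (j - 1) + (s.map fun k => k - 1).sum = i := by
  rw [mem_hatParts, Multiset.forall_mem_cons, Multiset.sum_cons, Multiset.map_cons,
    Multiset.sum_cons, and_assoc]

/-- The pairs of a part and the multiset of the remaining parts of an element of `hatParts`. -/
def hatPairs (n i : ℕ) : Finset (ℕ × Multiset ℕ) :=
  ((hatParts n i).sigma fun s => s.toFinset).image fun x => (x.2, x.1.erase x.2)

theorem mem_hatPairs {n i : ℕ} {x : ℕ × Multiset ℕ} :
    x ∈ hatPairs n i ↔ 2 ≤ x.1 ∧ (∀ k ∈ x.2, 2 ≤ k) ∧ x.1 + x.2.sum = n ∧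
      (x.1 - 1) + (x.2.map fun k => k - 1).sum = i := by
  rw [← mem_hatParts_cons, hatPairs, Finset.mem_image]
  constructor
  · rintro ⟨⟨s, j⟩, h, rfl⟩
    rw [Finset.mem_sigma, Multiset.mem_toFinset] at h
    rw [Multiset.cons_erase h.2]
    exact h.1
  · intro h
    refine ⟨⟨x.1 ::ₘ x.2, x.1⟩, ?_, ?_⟩
    · rw [Finset.mem_sigma, Multiset.mem_toFinset]
      exact ⟨h, Multiset.mem_cons_self _ _⟩
    · rw [Multiset.erase_cons_head]

theorem dp_sum_hatParts_eq {G : ℕ → ℕ → SymmFun} (h0 : ∀ j, G j 0 = 1)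
    (h1 : ∀ j m, j ≠ 0 → dp (G j (m + 1)) = G j m * p 1 ^ (j - 1)) (n i : ℕ) :
    dp (∑ s ∈ hatParts n i, multProd G s) =
      ∑ x ∈ hatPairs n i, p 1 ^ (x.1 - 1) * multProd G x.2 := by
  rw [map_sum, hatPairs, Finset.sum_image, Finset.sum_sigma]
  · exact Finset.sum_congr rfl fun s hs => dp_multProd h0 h1 (mem_hatParts.1 hs).1
  · rintro ⟨s, j⟩ hs ⟨t, k⟩ ht h
    simp only [Finset.coe_sigma, Set.mem_sigma_iff, Finset.mem_coe, Multiset.mem_toFinset,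
      Prod.mk.injEq] at hs ht h
    obtain ⟨rfl, h⟩ := h
    -- The pair determines the multiset: putting the part back recovers it.
    have h2 : s = t := by rw [← Multiset.cons_erase hs.2, h, Multiset.cons_erase ht.2]
    rw [h2]

theorem dp_sum_hatParts {G : ℕ → ℕ → SymmFun} (h0 : ∀ j, G j 0 = 1)
    (h1 : ∀ j m, j ≠ 0 → dp (G j (m + 1)) = G j m * p 1 ^ (j - 1)) (n i : ℕ) :
    dp (∑ s ∈ hatParts (n + 2) (i + 1), multProd G s) =
      p 1 * (dp (∑ s ∈ hatParts (n + 1) i, multProd G s) + ∑ s ∈ hatParts n i, multProd G s) := by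
  rw [dp_sum_hatParts_eq h0 h1, dp_sum_hatParts_eq h0 h1,
    ← Finset.sum_filter_add_sum_filter_not _ (fun x => x.1 ≠ 2), mul_add,
    Finset.mul_sum, Finset.mul_sum]
  refine congrArg₂ (· + ·) ?_ ?_
  -- A marked part at least 3 can be lowered by one and stays at least 2; size, rank and the
  -- exponent of `p 1` all drop by one.
  · refine Finset.sum_bij' (fun x _ => (x.1 - 1, x.2)) (fun x _ => (x.1 + 1, x.2)) ?_ ?_ ?_ ?_ ?_
    · intro x h
      rw [Finset.mem_filter, mem_hatPairs] at h
      rw [mem_hatPairs]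
      obtain ⟨⟨h1, h2, h3, h4⟩, h5⟩ := h
      exact ⟨by dsimp only; omega, h2, by dsimp only; omega, by dsimp only; omega⟩
    · intro x h
      rw [mem_hatPairs] at h
      rw [Finset.mem_filter, mem_hatPairs]
      obtain ⟨h1, h2, h3, h4⟩ := h
      exact ⟨⟨by dsimp only; omega, h2, by dsimp only; omega, by dsimp only; omega⟩,
        by dsimp only; omega⟩
    · intro x h
      rw [Finset.mem_filter, mem_hatPairs] at h
      have : x.1 - 1 + 1 = x.1 := by omega
      rw [this]
    · intro x _
      rfl
    · intro x h
      rw [Finset.mem_filter, mem_hatPairs] at h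
      have h2 : x.1 - 1 = (x.1 - 1 - 1) + 1 := by omega
      rw [← mul_assoc, ← pow_succ', ← h2]
  -- A marked part 2 is dropped: the size falls by 2, the rank by 1, and one factor `p 1` is left.
  · refine Finset.sum_bij' (fun x _ => x.2) (fun s _ => (2, s)) ?_ ?_ ?_ ?_ ?_
    · intro x h
      rw [Finset.mem_filter, mem_hatPairs] at h
      rw [mem_hatParts]
      obtain ⟨⟨h1, h2, h3, h4⟩, h5⟩ := h
      exact ⟨h2, by omega, by omega⟩
    · intro s h
      rw [mem_hatParts] at h
      rw [Finset.mem_filter, mem_hatPairs]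
      obtain ⟨h1, h2, h3⟩ := h
      exact ⟨⟨le_rfl, h1, by dsimp only; omega, by dsimp only; omega⟩, by simp⟩
    · intro x h
      rw [Finset.mem_filter, not_not] at h
      rw [← h.2]
    · intro s _
      rfl
    · intro x h
      rw [Finset.mem_filter, not_not] at h
      rw [h.2, pow_one]

/-- The factors of `chLie`. -/
def lieFactor (j m : ℕ) : SymmFun := plethysm (h m) (ell j)

/-- The factors of `chW`. -/
def whitneyFactor (j m : ℕ) : SymmFun :=
  if Odd j then plethysm (h m) (piSymm j) else plethysm (e m) (piSymm j)

theorem chLieHat_eq (n i : ℕ) : chLieHat n i = ∑ s ∈ hatParts n i, multProd lieFactor s :=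
  sum_hatPartitions n i (multProd lieFactor)

theorem chWHat_eq (n i : ℕ) : chWHat n i = ∑ s ∈ hatParts n i, multProd whitneyFactor s :=
  sum_hatPartitions n i (multProd whitneyFactor)

theorem dp_chLieHat (n i : ℕ) :
    dp (chLieHat (n + 2) (i + 1)) = p 1 * (dp (chLieHat (n + 1) i) + chLieHat n i) := by
  simp only [chLieHat_eq]
  refine dp_sum_hatParts (fun j => plethysm_h_zero _) (fun j m hj => ?_) n i
  rw [lieFactor, dp_plethysm, dp_h_succ, dp_ell hj, lieFactor]

theorem dp_chWHat (n i : ℕ) :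
    dp (chWHat (n + 2) (i + 1)) = p 1 * (dp (chWHat (n + 1) i) + chWHat n i) := by
  simp only [chWHat_eq]
  refine dp_sum_hatParts (fun j => ?_) (fun j m hj => ?_) n i
  · rw [whitneyFactor]
    split_ifs
    · exact plethysm_h_zero _
    · exact plethysm_e_zero _
  · rw [whitneyFactor, whitneyFactor]
    split_ifs
    · rw [dp_plethysm, dp_h_succ, dp_piSymm hj]
    · rw [dp_plethysm, dp_e_succ, dp_piSymm hj]

end Recurrence

section Isomorphism

/-- A differential recurrence between Frobenius images gives an isomorphism between the
restriction and the induced representation. -/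
theorem nonempty_equiv_of_dp_eq {n : ℕ} {A B C : Type*} [AddCommGroup A] [Module ℂ A]
    [AddCommGroup B] [Module ℂ B] [AddCommGroup C] [Module ℂ C]
    {α : Representation ℂ (Perm (Fin (n + 2))) A} {β : Representation ℂ (Perm (Fin (n + 1))) B}
    {γ : Representation ℂ (Perm (Fin n)) C} {a b c : SymmFun} (hα : HasFrobeniusImage α a)
    (hβ : HasFrobeniusImage β b) (hγ : HasFrobeniusImage γ c) (h : dp a = p 1 * (dp b + c)) :
    Nonempty ((res α).Equiv (ind (n + 1) ((res β).prod γ))) := by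
  have := hα.finiteDimensional
  have := hβ.finiteDimensional
  have := hγ.finiteDimensional
  refine nonempty_equiv_of_character_eq _ _
    (ch_injective (fun v w => Representation.char_conj _ w v)
      (fun v w => Representation.char_conj _ w v) ?_)
  have h1 : ch (n + 1) (res α).character = dp a := by
    rw [← hα.ch_character, dp_ch _ fun v w => Representation.char_conj _ w v]
    rfl
  have h2 : ch n (res β).character = dp b := by
    rw [← hβ.ch_character, dp_ch _ fun v w => Representation.char_conj _ w v]
    rfl
  refine h1.trans (h.trans ?_)
  refine Eq.trans ?_ (ch_character_ind_incl (n := n) ((res β).prod γ)).symm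
  rw [character_prod]
  refine congrArg (p 1 * ·) (Eq.trans ?_ (ch_add _ _ _).symm)
  exact congrArg₂ (· + ·) h2.symm hγ.ch_character.symm

end Isomorphism

end Recurrences

/-! ### Cycle structure of wreath products. -/

section WreathCycles

open Equiv Equiv.Perm Function

section Twist

variable {A B H : Type*} [Group H]

/-- The permutation `(a, b) ↦ (φ(x_b) a, σ b)` of `A × B`. -/
def twist (φ : H →* Perm A) (x : B → H) (σ : Perm B) : Perm (A × B) where
  toFun c := (φ (x c.2) c.1, σ c.2)
  invFun c := ((φ (x (σ⁻¹ c.2)))⁻¹ c.1, σ⁻¹ c.2)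
  left_inv c := by simp
  right_inv c := by simp

/-- The ordered product `x_{σ^{n-1} b} ⋯ x_{σ b} x_b`. -/
def pathProd (x : B → H) (σ : Perm B) (b : B) : ℕ → H
  | 0 => 1
  | n + 1 => x ((σ ^ n) b) * pathProd x σ b n

theorem twist_pow_apply (φ : H →* Perm A) (x : B → H) (σ : Perm B) (n : ℕ) (a : A) (b : B) :
    (twist φ x σ ^ n) (a, b) = (φ (pathProd x σ b n) a, (σ ^ n) b) := by
  induction n with
  | zero => simp [pathProd]
  | succ n ih =>
    rw [pow_succ', Perm.mul_apply, ih, pow_succ', Perm.mul_apply, pathProd, map_mul, Perm.mul_apply]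
    rfl

theorem pathProd_mul (x : B → H) (σ : Perm B) (b : B) {k : ℕ} (hk : (σ ^ k) b = b) (m : ℕ) :
    pathProd x σ b (k * m) = pathProd x σ b k ^ m := by
  have key : ∀ n, pathProd x σ b (k + n) = pathProd x σ b n * pathProd x σ b k := by
    intro n
    induction n with
    | zero => simp [pathProd]
    | succ n ih =>
      rw [← add_assoc, pathProd, ih, pathProd, mul_assoc, add_comm k n, pow_add, Perm.mul_apply, hk]
  induction m with
  | zero => simp [pathProd]
  | succ m ih => rw [Nat.mul_succ, add_comm, key, ih, pow_succ]

theorem twist_pow_apply_mul (φ : H →* Perm A) (x : B → H) (σ : Perm B) (b : B) (a : A) (m : ℕ) :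
    (twist φ x σ ^ (minimalPeriod σ b * m)) (a, b) =
      ((φ (pathProd x σ b (minimalPeriod σ b)) ^ m) a, b) := by
  have hb : (σ ^ minimalPeriod σ b) b = b := by
    rw [← iterate_eq_pow, iterate_minimalPeriod]
  have hb' : (σ ^ (minimalPeriod σ b * m)) b = b := by
    rw [pow_mul]
    exact Perm.pow_apply_eq_self_of_apply_eq_self hb m
  rw [twist_pow_apply, pathProd_mul x σ b hb, hb', map_pow]

theorem pow_apply_eq_iff_dvd {X : Type*} (π : Perm X) (c : X) (n : ℕ) :
    (π ^ n) c = c ↔ minimalPeriod π c ∣ n := by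
  rw [← isPeriodicPt_iff_minimalPeriod_dvd, IsPeriodicPt, IsFixedPt, iterate_eq_pow]

/-- A return to `(a, b)` is in particular a return to `b`. One turn around the cycle of `b` acts on
the first coordinate through the path product. -/
theorem minimalPeriod_twist (φ : H →* Perm A) (x : B → H) (σ : Perm B) (b : B) (a : A) :
    minimalPeriod (twist φ x σ) (a, b) =
      minimalPeriod σ b * minimalPeriod (φ (pathProd x σ b (minimalPeriod σ b))) a := by
  apply Nat.dvd_antisymm
  · rw [← pow_apply_eq_iff_dvd, twist_pow_apply_mul,
      (pow_apply_eq_iff_dvd (φ _) a _).2 dvd_rfl]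
  · have h1 : (twist φ x σ ^ minimalPeriod (twist φ x σ) (a, b)) (a, b) = (a, b) :=
      (pow_apply_eq_iff_dvd _ _ _).2 dvd_rfl
    have h2 : minimalPeriod σ b ∣ minimalPeriod (twist φ x σ) (a, b) := by
      rw [twist_pow_apply] at h1
      exact (pow_apply_eq_iff_dvd _ _ _).1 (congrArg Prod.snd h1)
    obtain ⟨m, hm⟩ := h2
    rw [hm] at h1 ⊢
    rw [twist_pow_apply_mul] at h1
    exact Nat.mul_dvd_mul_left _ ((pow_apply_eq_iff_dvd _ _ _).1 (congrArg Prod.fst h1))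

/-- The product of the `x_b` around a cycle of `σ`, starting at the chosen representative. -/
def cycleProd (σ : Perm B) (x : B → H) (q : Quotient (SameCycle.setoid σ)) : H :=
  pathProd x σ q.out (cycleLength σ q)

/-- Every cycle lying over `q` meets the fibre above `q.out`, where the first return map is `φ
(cycleProd σ x q)`. Its cycles are thus stretched by the length of `q`, which is the substitution
defining plethysm. -/
theorem cycleMonomial_twist [Finite A] [Finite B]
    (φ : H →* Perm A) (x : B → H) (σ : Perm B) [Fintype (Quotient (SameCycle.setoid σ))] :
    cycleMonomial (twist φ x σ) = ∏ q : Quotient (SameCycle.setoid σ),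
      powerSubst (cycleLength σ q).toPNat' (cycleMonomial (φ (cycleProd σ x q))) := by
  refine cycleMonomial_eq_prod _ _ _ (fun q a => (a, q.out)) ?_ ?_ ?_ ?_
  · intro q r a b h
    obtain ⟨n, hn⟩ := h.exists_nat_pow_eq
    rw [twist_pow_apply] at hn
    rw [← Quotient.out_eq q, ← Quotient.out_eq r]
    exact Quotient.sound ⟨n, by simpa using congrArg Prod.snd hn⟩
  · intro q a b
    rw [cycleProd, cycleLength_eq_out]
    constructor
    · intro h
      obtain ⟨n, hn⟩ := h.exists_nat_pow_eq
      have h2 : minimalPeriod σ q.out ∣ n := by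
        rw [twist_pow_apply] at hn
        exact (pow_apply_eq_iff_dvd _ _ _).1 (congrArg Prod.snd hn)
      obtain ⟨m, rfl⟩ := h2
      rw [twist_pow_apply_mul] at hn
      exact ⟨m, by simpa using congrArg Prod.fst hn⟩
    · intro h
      obtain ⟨n, hn⟩ := h.exists_nat_pow_eq
      exact ⟨(minimalPeriod σ q.out * n : ℕ), by rw [zpow_natCast, twist_pow_apply_mul, hn]⟩
  · rintro ⟨a, b⟩
    have h : σ.SameCycle (Quotient.mk (SameCycle.setoid σ) b).out b :=
      Quotient.mk_out (s := SameCycle.setoid σ) b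
    obtain ⟨n, hn⟩ := h.exists_nat_pow_eq
    refine ⟨Quotient.mk _ b, (φ (pathProd x σ (Quotient.mk (SameCycle.setoid σ) b).out n))⁻¹ a,
      n, ?_⟩
    rw [zpow_natCast, twist_pow_apply, hn]
    simp
  · intro q a
    rw [minimalPeriod_twist, cycleProd, cycleLength_eq_out, Nat.toPNat'_coe,
      if_pos (minimalPeriod_pos_of_finite σ q.out)]

theorem prod_eq_prod_cycles [Fintype B] {M : Type*} [CommMonoid M] (σ : Perm B)
    [Fintype (Quotient (SameCycle.setoid σ))] (f : B → M) :
    ∏ b, f b = ∏ q : Quotient (SameCycle.setoid σ),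
      ∏ i ∈ Finset.range (cycleLength σ q), f ((σ ^ i) q.out) := by
  classical
  rw [← Finset.prod_fiberwise (s := Finset.univ)
    (g := fun b => (Quotient.mk (SameCycle.setoid σ) b))]
  refine Finset.prod_congr rfl fun q _ => ?_
  symm
  refine Finset.prod_bij (fun i _ => (σ ^ i) q.out) ?_ ?_ ?_ ?_
  · intro i _
    rw [Finset.mem_filter]
    refine ⟨Finset.mem_univ _, ?_⟩
    conv_rhs => rw [← Quotient.out_eq q]
    exact Quotient.sound (SameCycle.symm ⟨i, by simp⟩)
  · intro i hi j hj h
    rw [Finset.mem_range, cycleLength_eq_out] at hi hj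
    rw [← iterate_eq_pow, ← iterate_eq_pow] at h
    exact iterate_injOn_Iio_minimalPeriod hi hj h
  · intro b hb
    have hb' : Quotient.mk (SameCycle.setoid σ) b = q := (Finset.mem_filter.1 hb).2
    subst hb'
    have h : σ.SameCycle (Quotient.mk (SameCycle.setoid σ) b).out b :=
      Quotient.mk_out (s := SameCycle.setoid σ) b
    obtain ⟨n, hn⟩ := h.exists_nat_pow_eq
    refine ⟨n % cycleLength σ (Quotient.mk _ b), ?_, ?_⟩
    · exact Finset.mem_range.2 (Nat.mod_lt _ (cycleLength_pos _ _))
    · refine Eq.trans ?_ hn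
      rw [← iterate_eq_pow, ← iterate_eq_pow, cycleLength_eq_out, iterate_mod_minimalPeriod_eq]
  · intro i _
    rfl

theorem map_pathProd {M : Type*} [CommMonoid M] (ψ : H →* M) (x : B → H) (σ : Perm B) (b : B)
    (n : ℕ) : ψ (pathProd x σ b n) = ∏ i ∈ Finset.range n, ψ (x ((σ ^ i) b)) := by
  induction n with
  | zero => simp [pathProd]
  | succ n ih => rw [pathProd, map_mul, ih, Finset.prod_range_succ, mul_comm]

theorem prod_map_eq_prod_cycleProd [Fintype B] {M : Type*} [CommMonoid M] (ψ : H →* M) (σ : Perm B)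
    [Fintype (Quotient (SameCycle.setoid σ))] (x : B → H) :
    ∏ b, ψ (x b) = ∏ q, ψ (cycleProd σ x q) := by
  rw [prod_eq_prod_cycles σ]
  exact Finset.prod_congr rfl fun q _ => (map_pathProd ψ x σ _ _).symm

open Classical in
/-- Translation of a family at the chosen representatives of the cycles. -/
def translate (σ : Perm B) (y : Quotient (SameCycle.setoid σ) → H) : (B → H) ≃ (B → H) :=
  Equiv.piCongrRight fun b =>
    Equiv.mulRight (if (Quotient.mk (SameCycle.setoid σ) b).out = b then y (Quotient.mk _ b) else 1)

/-- The representative is visited once, at the start, so its entry is the rightmost factor of the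
ordered product. Hence the cycle products can be translated independently of one another. -/
theorem cycleProd_translate [Finite B] (σ : Perm B) (y : Quotient (SameCycle.setoid σ) → H)
    (x : B → H) (q : Quotient (SameCycle.setoid σ)) :
    cycleProd σ (translate σ y x) q = cycleProd σ x q * y q := by
  have key : ∀ n, n < cycleLength σ q →
      pathProd (translate σ y x) σ q.out (n + 1) = pathProd x σ q.out (n + 1) * y q := by
    intro n
    induction n with
    | zero =>
      intro _
      simp [pathProd, translate]
    | succ n ih =>
      intro hn
      rw [pathProd, ih (by omega), pathProd.eq_2 x σ q.out (n + 1), mul_assoc (x _)]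
      have h1 : (Quotient.mk (SameCycle.setoid σ) ((σ ^ (n + 1)) q.out)) = q := by
        conv_rhs => rw [← Quotient.out_eq q]
        exact Quotient.sound (SameCycle.symm ⟨(n + 1 : ℕ), by rw [zpow_natCast]⟩)
      have h2 : (Quotient.mk (SameCycle.setoid σ) ((σ ^ (n + 1)) q.out)).out ≠
          (σ ^ (n + 1)) q.out := fun h => by
        rw [h1] at h
        have h3 := Nat.le_of_dvd (Nat.succ_pos n) ((pow_apply_eq_iff_dvd _ _ _).1 h.symm)
        rw [cycleLength_eq_out] at hn
        omega
      simp only [translate, Equiv.piCongrRight_apply, Pi.map_apply, Equiv.coe_mulRight,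
        if_neg h2, mul_one]
  obtain ⟨k, hk⟩ := Nat.exists_eq_succ_of_ne_zero (cycleLength_pos σ q).ne'
  rw [cycleProd, cycleProd, hk]
  exact key k (by omega)

end Twist

/-- Summing a product of functions of equidistributed independent elements of a group. -/
theorem sum_prod_of_translate {X O H R : Type*} [Fintype X] [Fintype O] [DecidableEq O] [Group H]
    [Fintype H] [CommRing R] [Algebra ℂ R] (g : X → O → H) (t : (O → H) → X ≃ X)
    (ht : ∀ y x o, g (t y x) o = g x o * y o) (θ : O → H → R) :
    ∑ x, ∏ o, θ o (g x o) =
      (Fintype.card X : ℂ) • ∏ o, (Fintype.card H : ℂ)⁻¹ • ∑ y, θ o y := by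
  have hH : ((Fintype.card H : ℂ) ^ Fintype.card O) ≠ 0 := pow_ne_zero _ (by simp)
  rw [Finset.prod_smul, Finset.prod_const, Finset.card_univ, smul_comm, inv_pow,
    eq_inv_smul_iff₀ hH]
  -- The sum is unchanged by each translation, so it may be averaged over all `y`; for fixed `x` the
  -- elements `g x o * y o` then range over `H` independently.
  have h1 : ∀ y : O → H, ∑ x, ∏ o, θ o (g x o) = ∑ x, ∏ o, θ o (g x o * y o) := fun y => by
    rw [← Equiv.sum_comp (t y)]
    simp only [ht]
  have h2 : ((Fintype.card H : ℂ) ^ Fintype.card O) • ∑ x, ∏ o, θ o (g x o) =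
      ∑ y : O → H, ∑ x, ∏ o, θ o (g x o * y o) := by
    rw [← Finset.sum_congr rfl fun y _ => h1 y, Finset.sum_const, Finset.card_univ,
      Fintype.card_fun, ← Nat.cast_pow, Nat.cast_smul_eq_nsmul]
  rw [h2, Finset.sum_comm]
  have h3 : ∀ x, ∑ y : O → H, ∏ o, θ o (g x o * y o) = ∏ o, ∑ y, θ o y := by
    intro x
    rw [← Fintype.piFinset_univ, ← Finset.prod_univ_sum (fun _ => Finset.univ)
      fun o y => θ o (g x o * y)]
    exact Finset.prod_congr rfl fun o _ => Equiv.sum_comp (Equiv.mulLeft (g x o)) (θ o)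
  rw [Finset.sum_congr rfl fun x _ => h3 x, Finset.sum_const, Finset.card_univ,
    Nat.cast_smul_eq_nsmul]

section CycleIndex

/-- The cycle index of a finite group `H` acting on `A`, weighted by a linear character. -/
def cycleIndex {A H : Type} [Group H] [Fintype H] (φ : H →* Perm A) (ψ : H →* ℂˣ) : SymmFun :=
  (Fintype.card H : ℂ)⁻¹ • ∑ x : H, (ψ x : ℂ) • cycleMonomial (φ x)

/-- For fixed `σ` both weight and monomial factor over the cycles of `σ` as functions of the cycle
products, which are independent and uniform. A cycle of length $k$ therefore averages to $p_k$ of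
the cycle index. -/
theorem sum_cycleMonomial_twist {A B H : Type} [Group H] [Fintype H] [Finite A] [Fintype B]
    [DecidableEq B] (φ : H →* Perm A) (ψ : H →* ℂˣ) (σ : Perm B) :
    ∑ x : B → H, ((∏ b, ψ (x b) : ℂˣ) : ℂ) • cycleMonomial (twist φ x σ) =
      (Fintype.card (B → H) : ℂ) • plethysm (cycleMonomial σ) (cycleIndex φ ψ) := by
  classical
  have := Fintype.ofFinite (Quotient (SameCycle.setoid σ))
  have h1 : plethysm (cycleMonomial σ) (cycleIndex φ ψ) =
      ∏ q : Quotient (SameCycle.setoid σ), (Fintype.card H : ℂ)⁻¹ •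
        ∑ y : H, (ψ y : ℂ) • powerSubst (cycleLength σ q).toPNat' (cycleMonomial (φ y)) := by
    rw [cycleMonomial, finprod_eq_prod_of_fintype, plethysm, map_prod]
    refine Finset.prod_congr rfl fun q _ => ?_
    rw [p, MvPolynomial.aeval_X, cycleIndex, map_smul, map_sum]
    simp only [map_smul]
  rw [h1, ← sum_prod_of_translate (fun x q => cycleProd σ x q) (translate σ)
    (fun y x q => cycleProd_translate σ y x q)
    (fun q y => (ψ y : ℂ) • powerSubst (cycleLength σ q).toPNat' (cycleMonomial (φ y)))]
  refine Finset.sum_congr rfl fun x _ => ?_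
  rw [cycleMonomial_twist φ x σ, prod_map_eq_prod_cycleProd ψ σ, Units.coe_prod, Finset.prod_smul]

end CycleIndex

end WreathCycles

/-! ### Existence of the representations through weighted cycle indices. -/

section Existence

open Equiv Equiv.Perm

section Wreath

variable {A B H : Type} [Group H]

/-- The wreath product of `H` with the symmetric group of `B`. -/
abbrev Wreath (B H : Type) [Group H] : Type := (B → H) ⋊[mulAutArrow] Perm B

instance [Fintype B] [DecidableEq B] [Fintype H] : Fintype (Wreath B H) :=
  Fintype.ofEquiv _ SemidirectProduct.equivProd.symm

/-- The action of the wreath product on `A × B`. -/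
def wreathHom (φ : H →* Perm A) : Wreath B H →* Perm (A × B) :=
  -- In the semidirect product the entries of `w.left` are indexed by the target block, in `twist`
  -- by the source block; hence the evaluation at `w.right b`.
  MonoidHom.mk' (fun w => twist φ (fun b => w.left (w.right b)) w.right) fun v w => by
    refine Equiv.ext fun c => Prod.ext ?_ rfl
    change φ (v.left (v.right (w.right c.2)) *
      w.left (v.right⁻¹ (v.right (w.right c.2)))) c.1 = _
    rw [show v.right⁻¹ (v.right (w.right c.2)) = w.right c.2 by simp, map_mul]
    rfl

/-- The linear character of the wreath product given by linear characters of the factors. -/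
def wreathChar [Fintype B] (ψ : H →* ℂˣ) (ε : Perm B →* ℂˣ) : Wreath B H →* ℂˣ :=
  MonoidHom.mk' (fun w => (∏ b, ψ (w.left b)) * ε w.right) fun v w => by
    have h : ∏ b, ψ ((mulAutArrow v.right w.left) b) = ∏ b, ψ (w.left b) :=
      Equiv.prod_comp v.right⁻¹ fun b => ψ (w.left b)
    simp only [SemidirectProduct.mul_left, SemidirectProduct.mul_right, map_mul, Pi.mul_apply,
      Finset.prod_mul_distrib, h]
    exact mul_mul_mul_comm _ _ _ _

theorem cycleIndex_wreath [Fintype H] [Finite A] (φ : H →* Perm A) (ψ : H →* ℂˣ) (m : ℕ)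
    (ε : Perm (Fin m) →* ℂˣ) :
    cycleIndex (wreathHom (B := Fin m) φ) (wreathChar ψ ε) =
      plethysm (ch m fun w => ε w) (cycleIndex φ ψ) := by
  have hcard : Fintype.card (Wreath (Fin m) H) = Fintype.card (Fin m → H) * m.factorial := by
    rw [Fintype.card_congr SemidirectProduct.equivProd, Fintype.card_prod, card_perm_fin]
  have h0 : (Fintype.card (Fin m → H) : ℂ) ≠ 0 := by simp
  have h1 : ∑ w : Wreath (Fin m) H, (wreathChar ψ ε w : ℂ) • cycleMonomial (wreathHom φ w) =
      ∑ σ : Perm (Fin m), (ε σ : ℂ) • ∑ x : Fin m → H,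
        ((∏ b, ψ (x b) : ℂˣ) : ℂ) • cycleMonomial (twist φ x σ) := by
    rw [← Equiv.sum_comp SemidirectProduct.equivProd.symm, Fintype.sum_prod_type_right]
    refine Finset.sum_congr rfl fun σ _ => ?_
    -- Reindexing by `σ` undoes the shift in `wreathHom` and leaves the weight unchanged.
    rw [← Equiv.sum_comp (Equiv.arrowCongr σ (Equiv.refl H)), Finset.smul_sum]
    refine Finset.sum_congr rfl fun x _ => ?_
    rw [smul_smul, mul_comm, ← Units.val_mul]
    have h2 : ∏ b, ψ (x (σ.symm b)) = ∏ b, ψ (x b) := Equiv.prod_comp σ.symm fun b => ψ (x b)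
    have h3 : (fun b => x (σ.symm (σ b))) = x := by simp
    change (((∏ b, ψ (x (σ.symm b))) * ε σ : ℂˣ) : ℂ) •
      cycleMonomial (twist φ (fun b => x (σ.symm (σ b))) σ) = _
    rw [h2, h3]
  rw [cycleIndex, h1, hcard, ch_eq_smul]
  simp only [sum_cycleMonomial_twist, pPart_partition, plethysm, map_smul, map_sum]
  rw [Nat.cast_mul, mul_inv_rev, mul_smul]
  congr 1
  rw [Finset.smul_sum]
  refine Finset.sum_congr rfl fun σ _ => ?_
  rw [smul_comm (ε σ : ℂ), smul_smul, inv_mul_cancel₀ h0, one_smul]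

end Wreath

/-- `F` is the cycle index of a finite group acting on `n` points, weighted by a linear
character. -/
def IsCycleIndex (n : ℕ) (F : SymmFun) : Prop :=
  ∃ (A H : Type) (_ : Fintype A) (_ : Group H) (_ : Fintype H) (φ : H →* Perm A) (ψ : H →* ℂˣ),
    Fintype.card A = n ∧ cycleIndex φ ψ = F

theorem isCycleIndex_one : IsCycleIndex 0 1 := by
  refine ⟨Empty, Unit, inferInstance, inferInstance, inferInstance, 1, 1, rfl, ?_⟩
  have : cycleMonomial (1 : Perm Empty) = 1 := by
    rw [← pPart_partition, pPart, parts_partition]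
    simp
  simp [cycleIndex, this]

/-- The direct product of the groups acts on the disjoint union, where cycle monomials multiply. -/
theorem IsCycleIndex.mul {m n : ℕ} {F G : SymmFun} (hF : IsCycleIndex m F)
    (hG : IsCycleIndex n G) : IsCycleIndex (m + n) (F * G) := by
  obtain ⟨A, H, _, _, _, φ, ψ, rfl, rfl⟩ := hF
  obtain ⟨A', H', _, _, _, φ', ψ', rfl, rfl⟩ := hG
  refine ⟨A ⊕ A', H × H', inferInstance, inferInstance, inferInstance,
    (sumCongrHom A A').comp (φ.prodMap φ'), ψ.coprod ψ', Fintype.card_sum, ?_⟩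
  rw [cycleIndex, cycleIndex, cycleIndex, Fintype.sum_prod_type, smul_mul_smul_comm,
    Finset.sum_mul_sum, Fintype.card_prod, Nat.cast_mul, mul_inv]
  congr 1
  refine Finset.sum_congr rfl fun x _ => Finset.sum_congr rfl fun y _ => ?_
  rw [smul_mul_smul_comm, ← cycleMonomial_sumCongr]
  simp

theorem IsCycleIndex.prod {ι : Type*} (s : Finset ι) (d : ι → ℕ) (F : ι → SymmFun)
    (h : ∀ i ∈ s, IsCycleIndex (d i) (F i)) : IsCycleIndex (∑ i ∈ s, d i) (∏ i ∈ s, F i) := by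
  classical
  induction s using Finset.induction_on with
  | empty => simpa using isCycleIndex_one
  | insert a s ha ih =>
    rw [Finset.sum_insert ha, Finset.prod_insert ha]
    exact (h a (Finset.mem_insert_self a s)).mul
      (ih fun i hi => h i (Finset.mem_insert_of_mem hi))

theorem IsCycleIndex.plethysm {n : ℕ} {F : SymmFun} (hF : IsCycleIndex n F) (m : ℕ)
    (ε : Perm (Fin m) →* ℂˣ) : IsCycleIndex (m * n) (plethysm (ch m fun w => ε w) F) := by
  obtain ⟨A, H, _, _, _, φ, ψ, rfl, rfl⟩ := hF
  refine ⟨A × Fin m, Wreath (Fin m) H, inferInstance, inferInstance, inferInstance,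
    wreathHom φ, wreathChar ψ ε, ?_, cycleIndex_wreath φ ψ m ε⟩
  rw [Fintype.card_prod, Fintype.card_fin, mul_comm]

/-- The sign character with values in `ℂˣ`. -/
def sgnHom (n : ℕ) : Perm (Fin n) →* ℂˣ := (Units.map (Int.castRingHom ℂ).toMonoidHom).comp sign

theorem IsCycleIndex.plethysm_h {n : ℕ} {F : SymmFun} (hF : IsCycleIndex n F) (m : ℕ) :
    IsCycleIndex (m * n) (HigherLie.plethysm (h m) F) :=
  hF.plethysm m 1

theorem IsCycleIndex.plethysm_e {n : ℕ} {F : SymmFun} (hF : IsCycleIndex n F) (m : ℕ) :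
    IsCycleIndex (m * n) (HigherLie.plethysm (e m) F) :=
  hF.plethysm m (sgnHom m)

/-- The one-dimensional representation afforded by a linear character. -/
def linRep {H : Type*} [Group H] (ψ : H →* ℂˣ) : Representation ℂ H ℂ :=
  ((Algebra.lmul ℂ ℂ : ℂ →ₐ[ℂ] Module.End ℂ ℂ) : ℂ →* Module.End ℂ ℂ).comp
    ((Units.coeHom ℂ).comp ψ)

theorem character_linRep {H : Type*} [Group H] (ψ : H →* ℂˣ) (x : H) :
    (linRep ψ).character x = ψ x := by
  change LinearMap.trace ℂ ℂ (Algebra.lmul ℂ ℂ (ψ x)) = ψ x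
  rw [LinearMap.trace_eq_matrix_trace ℂ (Module.Basis.singleton Unit ℂ)]
  simp [Matrix.trace, LinearMap.toMatrix_apply]

theorem isCycleIndex_ch_mul_lie (n : ℕ) (ε : Perm (Fin n) →* ℂˣ) :
    IsCycleIndex n (ch n fun w => ε w * (lieRep n).character w) := by
  have := Fintype.ofFinite (cyc n)
  refine ⟨Fin n, cyc n, inferInstance, inferInstance, inferInstance, (cyc n).subtype,
    ε.comp (cyc n).subtype * chiZeta n, Fintype.card_fin n, ?_⟩
  rw [lieRep, ch_mul_character_ind]
  · rw [cycleIndex]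
    simp only [pPart_partition]
    congr 1
    refine Finset.sum_congr rfl fun x _ => ?_
    rw [show (chiZetaRep n).character x = chiZeta n x from character_linRep _ x]
    rfl
  · intro v w
    rw [map_mul, map_mul, map_inv, mul_right_comm, mul_inv_cancel, one_mul]

theorem isCycleIndex_ell (n : ℕ) : IsCycleIndex n (ell n) := by
  simpa [ell] using isCycleIndex_ch_mul_lie n 1

theorem isCycleIndex_piSymm (n : ℕ) : IsCycleIndex n (piSymm n) :=
  isCycleIndex_ch_mul_lie n (sgnHom n)

theorem isCycleIndex_multProd {G : ℕ → ℕ → SymmFun} (hG : ∀ j m, IsCycleIndex (m * j) (G j m))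
    (s : Multiset ℕ) : IsCycleIndex s.sum (multProd G s) := by
  rw [Finset.sum_multiset_count]
  exact IsCycleIndex.prod _ _ _ fun j _ => hG j _

/-- `F` is the Frobenius image of a representation of `S_n`. -/
def IsGenuine (n : ℕ) (F : SymmFun) : Prop :=
  ∃ (V : Type) (_ : AddCommGroup V) (_ : Module ℂ V) (ρ : Representation ℂ (Perm (Fin n)) V),
    HasFrobeniusImage ρ F

/-- The linear character is induced along the action. Induction works along any homomorphism, so the
action need not be faithful. -/
theorem IsCycleIndex.isGenuine {n : ℕ} {F : SymmFun} (hF : IsCycleIndex n F) : IsGenuine n F := by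
  obtain ⟨A, H, _, _, _, φ, ψ, rfl, rfl⟩ := hF
  let f := Fintype.equivFin A
  refine ⟨_, inferInstance, inferInstance,
    Representation.ind (f.permCongrHom.toMonoidHom.comp φ) (linRep ψ), inferInstance, ?_⟩
  rw [ch_character_ind, cycleIndex]
  congr 1
  refine Finset.sum_congr rfl fun x _ => ?_
  rw [character_linRep, pPart_partition]
  congr 1
  exact cycleMonomial_congr f _ _ fun a => by simp

theorem isGenuine_zero (n : ℕ) : IsGenuine n 0 := by
  refine ⟨PUnit, inferInstance, inferInstance, Representation.trivial ℂ _ _, inferInstance, ?_⟩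
  have : (Representation.trivial ℂ (Perm (Fin n)) PUnit).character = 0 := by
    ext w
    rw [Representation.character, Subsingleton.elim (Representation.trivial ℂ _ PUnit w) 0, map_zero,
      Pi.zero_apply]
  rw [this, ch_eq_smul]
  simp

theorem IsGenuine.add {n : ℕ} {F G : SymmFun} (hF : IsGenuine n F) (hG : IsGenuine n G) :
    IsGenuine n (F + G) := by
  obtain ⟨V, _, _, ρ, hV, hρ⟩ := hF
  obtain ⟨W, _, _, σ, hW, hσ⟩ := hG
  refine ⟨V × W, inferInstance, inferInstance, ρ.prod σ, inferInstance, ?_⟩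
  rw [character_prod, ch_add, hρ, hσ]

theorem isGenuine_sum_hatParts {G : ℕ → ℕ → SymmFun} (hG : ∀ j m, IsCycleIndex (m * j) (G j m))
    (n i : ℕ) : IsGenuine n (∑ s ∈ hatParts n i, multProd G s) := by
  refine Finset.sum_induction _ (IsGenuine n) (fun _ _ => IsGenuine.add) (isGenuine_zero n)
    fun s hs => ?_
  have := (isCycleIndex_multProd hG s).isGenuine
  rwa [(mem_hatParts.1 hs).2.1] at this

theorem isGenuine_chLieHat (n i : ℕ) : IsGenuine n (chLieHat n i) := by
  rw [chLieHat_eq]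
  exact isGenuine_sum_hatParts (fun j m => (isCycleIndex_ell j).plethysm_h m) n i

theorem isGenuine_chWHat (n i : ℕ) : IsGenuine n (chWHat n i) := by
  rw [chWHat_eq]
  refine isGenuine_sum_hatParts (fun j m => ?_) n i
  rw [whitneyFactor]
  split_ifs
  · exact (isCycleIndex_piSymm j).plethysm_h m
  · exact (isCycleIndex_piSymm j).plethysm_e m

end Existence

end HigherLie

end

theorem theorem1p4 :
    -- the representations exist
    (∀ n i : ℕ,
      (∃ (V : Type) (_ : AddCommGroup V) (_ : Module ℂ V)
        (ρ : Representation ℂ (Equiv.Perm (Fin n)) V), HigherLie.IsLieHat n i ρ) ∧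
      (∃ (V : Type) (_ : AddCommGroup V) (_ : Module ℂ V)
        (ρ : Representation ℂ (Equiv.Perm (Fin n)) V), HigherLie.IsWHat n i ρ)) ∧
    -- the recurrences
    (∀ n i : ℕ, 2 ≤ n → 1 ≤ i →
      ∀ (A B C : Type*) [AddCommGroup A] [Module ℂ A] [AddCommGroup B] [Module ℂ B]
        [AddCommGroup C] [Module ℂ C]
        (α : Representation ℂ (Equiv.Perm (Fin n)) A)
        (β : Representation ℂ (Equiv.Perm (Fin (n - 1))) B)
        (γ : Representation ℂ (Equiv.Perm (Fin (n - 1 - 1))) C),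
        (HigherLie.IsLieHat n i α → HigherLie.IsLieHat (n - 1) (i - 1) β →
          HigherLie.IsLieHat (n - 1 - 1) (i - 1) γ →
          Nonempty ((HigherLie.res α).Equiv
            (HigherLie.ind (n - 1) ((HigherLie.res β).prod γ)))) ∧
        (HigherLie.IsWHat n i α → HigherLie.IsWHat (n - 1) (i - 1) β →
          HigherLie.IsWHat (n - 1 - 1) (i - 1) γ →
          Nonempty ((HigherLie.res α).Equiv
            (HigherLie.ind (n - 1) ((HigherLie.res β).prod γ))))) := by
  refine ⟨fun n i => ⟨HigherLie.isGenuine_chLieHat n i, HigherLie.isGenuine_chWHat n i⟩, ?_⟩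
  intro n i hn hi A B C _ _ _ _ _ _ α β γ
  -- With $n+2$ and $i+1$ in place of $n$ and $i$, the truncated subtractions reduce definitionally.
  obtain ⟨n, rfl⟩ := Nat.exists_eq_add_of_le' hn
  obtain ⟨i, rfl⟩ := Nat.exists_eq_add_of_le' hi
  exact ⟨fun hα hβ hγ => HigherLie.nonempty_equiv_of_dp_eq hα hβ hγ (HigherLie.dp_chLieHat n i),
    fun hα hβ hγ => HigherLie.nonempty_equiv_of_dp_eq hα hβ hγ (HigherLie.dp_chWHat n i)⟩
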